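/- All graphs are finite, undirected and simple (no loops, no multiple edges). For graphs $G,H$, the tensor (categorical) product $G\times H$ has vertex set $V(G)\times V(H)$, with $(g_0,h_0)$ adjacent to $(g_1,h_1)$ if and only if $g_0g_1\in E(G)$ and $h_0h_1\in E(H)$; write $G\to K$ if there exists a graph homomorphism from $G$ to $K$. A graph $K$ is square-free if it contains no four-cycle as a (not necessarily induced) subgraph, i.e. whenever $v_0v_1,v_1v_2,v_2v_3,v_3v_0\in E(K)$, then $v_0=v_2$ or $v_1=v_3$. A graph $K$ is multiplicative if, for all graphs $G,H$, $G\times H\to K$ implies $G\to K$ or $H\to K$. Theorem. Every square-free graph $K$ is multiplicative. In particular, there are multiplicative graphs of arbitrarily high chromatic number: for every $n\in\mathbb{N}$ there is a square-free, multiplicative graph $K$ with $\chi(K)\ge n$. -/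

import Mathlib

universe u v w

/-- The tensor (categorical) product `G × H`: two pairs are adjacent iff both their first
coordinates are adjacent in `G` and their second coordinates are adjacent in `H`. -/
def SimpleGraph.tensorProd {V W : Type*} (G : SimpleGraph V) (H : SimpleGraph W) :
    SimpleGraph (V × W) where
  Adj x y := G.Adj x.1 y.1 ∧ H.Adj x.2 y.2
  symm := ⟨fun _ _ h => ⟨h.1.symm, h.2.symm⟩⟩
  loopless := ⟨fun _ h => G.irrefl h.1⟩

/-- `G → K`: there is a graph homomorphism from `G` to `K`. -/
def SimpleGraph.MapsTo {V W : Type*} (G : SimpleGraph V) (K : SimpleGraph W) : Prop :=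
  Nonempty (G →g K)

/-- A graph is square-free if it contains no four-cycle as a (not necessarily induced) subgraph. -/
def SimpleGraph.IsSquareFree {V : Type*} (K : SimpleGraph V) : Prop :=
  ∀ v₀ v₁ v₂ v₃ : V, K.Adj v₀ v₁ → K.Adj v₁ v₂ → K.Adj v₂ v₃ → K.Adj v₃ v₀ →
    v₀ = v₂ ∨ v₁ = v₃

/-- A graph `K` is multiplicative if `G × H → K` implies `G → K` or `H → K`, for all (finite,
simple) graphs `G` and `H`. -/
def SimpleGraph.IsMultiplicative {V : Type u} (K : SimpleGraph V) : Prop :=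
  ∀ (X : Type v) (Y : Type w) [Finite X] [Finite Y] (G : SimpleGraph X) (H : SimpleGraph Y),
    (G.tensorProd H).MapsTo K → G.MapsTo K ∨ H.MapsTo K

/-! Components allow a reduction to `G` and `H` connected; an edgeless or bipartite factor maps to
`K` at once, so both may be taken non-bipartite. Label walks in `K` by a free group so that opposite
darts get inverse labels. Since `K` is square-free, the image of a four-cycle of `G × H` is
degenerate and has trivial label. Hence even closed walks in `G` and in `H`, run from a common base
vertex, have commuting labels, as on a torus (`alt_mul_alt_swap`). Commutation is transitive off `1`
in a free group, which leaves two cases.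

One factor, say `H`, contributes only trivial labels. Then every slice `{g} × H` lifts to a tree
covering a component of `K`, and the lift is a finite set with a centre and a radius. Along an edge
of `G` either the centre is kept and the radius changes by one, or the centre moves along an edge
and the radius is kept (`eq_or_adj`). Sending `g` to its projected centre is thus almost a
homomorphism to `K`; it is repaired by moving the centre one step when the radius is odd, in the
direction of a longest non-backtracking continuation (`SliceLift.mapsTo`).

Otherwise all labels of closed walks lie in a cyclic group (`isCyclic_loopSubgroup`). Its generator
translates the tree along an axis, and a Busemann function modulo the translation length `n` maps `G
× H` to a cycle of odd length `n` which itself maps to `K` (`exists_cycle_map`). Odd cycles are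
multiplicative by a parity argument on winding numbers (`exists_map_or`).

Large chromatic number comes from Descartes' construction, which preserves square-freeness. -/

/-! ### Centralizers in free groups -/

namespace FreeGroup

/-- A nontrivial element of a free group commutes with at most one of the free generators. -/
theorem eq_of_commute_of {α : Type*} {z : FreeGroup α} (hz : z ≠ 1) {a b : α}
    (ha : Commute z (of a)) (hb : Commute z (of b)) : a = b := by
  classical
  obtain ⟨⟨x, ε⟩, L, hL⟩ := List.exists_cons_of_ne_nil (mt toWord_eq_nil_iff.1 hz)
  -- If `c ≠ x`, nothing cancels in `c * z`, so its word starts with `c`. Being of full length, the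
  -- word of `z * c` is that of `z` followed by `c`, which starts with `x`.
  have key : ∀ c : α, Commute z (of c) → c = x := by
    intro c hc
    by_contra hcx
    have h1 : (of c * z).toWord = (c, true) :: z.toWord := by
      have hred : IsReduced ((c, true) :: z.toWord) := by
        rw [hL, isReduced_cons_cons, ← hL]
        exact ⟨fun h => absurd h hcx, isReduced_toWord⟩
      rw [toWord_mul, toWord_of]
      exact hred.reduce_eq
    have h2 := (toWord_mul_sublist z (of c))
    rw [hc.eq, h1, toWord_of] at h2
    have h3 := h2.eq_of_length (by simp)
    rw [hL] at h3
    simp only [List.cons_append, List.cons.injEq, Prod.mk.injEq] at h3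
    exact hcx h3.1.1
  rw [key a ha, key b hb]

/-- The centralizer of a nontrivial element of a free group is cyclic. -/
theorem isCyclic_centralizer {α : Type u} {z : FreeGroup α} (hz : z ≠ 1) :
    IsCyclic (Subgroup.centralizer {z}) := by
  let C := Subgroup.centralizer {z}
  let z' : C := ⟨z, by simp [C, Subgroup.mem_centralizer_iff]⟩
  -- By Nielsen–Schreier the centralizer is free; as `z` is central and nontrivial in it, it has at
  -- most one generator.
  let φ : C ≃* FreeGroup (IsFreeGroup.Generators C) := IsFreeGroup.toFreeGroup C
  have hz' : φ z' ≠ 1 := by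
    rw [Ne, map_eq_one_iff φ φ.injective]
    exact fun h => hz (congrArg Subtype.val h)
  have hcomm : ∀ y, Commute (φ z') y := by
    intro y
    obtain ⟨y, rfl⟩ := φ.surjective y
    refine Commute.map (f := φ) ?_
    have := y.2
    rw [Subgroup.mem_centralizer_singleton_iff] at this
    exact Subtype.ext this.symm
  have hsub : Subsingleton (IsFreeGroup.Generators C) :=
    ⟨fun a b => eq_of_commute_of hz' (hcomm _) (hcomm _)⟩
  have hcyc : IsCyclic (FreeGroup (IsFreeGroup.Generators C)) := by
    rcases isEmpty_or_nonempty (IsFreeGroup.Generators C) with h | ⟨⟨a⟩⟩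
    · infer_instance
    · have : Unique (IsFreeGroup.Generators C) := uniqueOfSubsingleton a
      infer_instance
  exact isCyclic_of_surjective φ.symm φ.symm.surjective

/-- Commutation is transitive on nontrivial elements of a free group. -/
theorem commute_trans {α : Type u} {a z b : FreeGroup α} (hz : z ≠ 1)
    (ha : Commute z a) (hb : Commute z b) : Commute a b := by
  have := isCyclic_centralizer hz
  let a' : Subgroup.centralizer {z} := ⟨a, Subgroup.mem_centralizer_singleton_iff.2 ha.eq.symm⟩
  let b' : Subgroup.centralizer {z} := ⟨b, Subgroup.mem_centralizer_singleton_iff.2 hb.eq.symm⟩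
  exact congrArg Subtype.val (
    (IsCyclic.isMulCommutative (α := Subgroup.centralizer {z})).is_comm.comm a' b')

end FreeGroup

/-! ### Universal covers of `K` -/

namespace SimpleGraph

variable {V : Type u}

/-- The label of the dart from `x` to `y` in the free group on all ordered pairs. -/
def dartLabel (x y : V) : FreeGroup (V × V) :=
  FreeGroup.of (x, y) * (FreeGroup.of (y, x))⁻¹

theorem dartLabel_mul_symm (x y : V) : dartLabel x y * dartLabel y x = 1 := by
  simp [dartLabel, mul_assoc]

/-- A disjoint union of universal covers of `K`, on which the free group on pairs of vertices acts
by left multiplication on the second component. -/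
def coverForest (K : SimpleGraph V) : SimpleGraph (V × FreeGroup (V × V)) where
  Adj p q := K.Adj p.1 q.1 ∧ q.2 = p.2 * dartLabel p.1 q.1
  symm := ⟨fun p q h => ⟨h.1.symm, by rw [h.2, mul_assoc, dartLabel_mul_symm, mul_one]⟩⟩
  loopless := ⟨fun _ h => K.irrefl h.1⟩

variable {K : SimpleGraph V}

/-- The word in the free group read along a walk in `coverForest K`. -/
def coverWord : {p q : V × FreeGroup (V × V)} → K.coverForest.Walk p q → List ((V × V) × Bool)
  | _, _, .nil => []
  | p, _, .cons (v := r) _ W => ((p.1, r.1), true) :: ((r.1, p.1), false) :: coverWord W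

theorem mk_coverWord : ∀ {p q : V × FreeGroup (V × V)} (W : K.coverForest.Walk p q),
    q.2 = p.2 * FreeGroup.mk (coverWord W)
  | _, _, .nil => by simp [coverWord, ← FreeGroup.one_eq_mk]
  | p, q, .cons (v := r) h W => by
    rw [mk_coverWord W, h.2, mul_assoc]
    congr 1

/-- A cancellation could only come from a dart followed by its reverse, and in the cover this
returns to the vertex just left. -/
theorem isReduced_coverWord {p q : V × FreeGroup (V × V)} (W : K.coverForest.Walk p q)
    (hW : W.IsPath) : FreeGroup.IsReduced (coverWord W) := by
  induction W with
  | nil => exact FreeGroup.IsReduced.nil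
  | @cons p r q h W ih =>
    have ih := ih hW.of_cons
    cases W with
    | nil =>
      simp only [coverWord, FreeGroup.isReduced_cons_cons, FreeGroup.IsReduced.singleton, and_true]
      intro h'
      exact absurd (congrArg Prod.fst h') h.1.ne
    | @cons _ s _ h' W =>
      rw [coverWord] at ih ⊢
      rw [coverWord, FreeGroup.isReduced_cons_cons, FreeGroup.isReduced_cons_cons]
      refine ⟨fun e => absurd (congrArg Prod.fst e) h.1.ne, fun e => ?_, ih⟩
      exfalso
      have e1 : p.1 = s.1 := congrArg Prod.snd e
      have e2 : p = s := by
        refine Prod.ext e1 ?_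
        rw [h'.2, h.2, mul_assoc, ← e1, dartLabel_mul_symm, mul_one]
      have := hW.support_nodup
      simp [e2] at this

theorem eq_of_coverWord_eq : ∀ {p q : V × FreeGroup (V × V)} (W W' : K.coverForest.Walk p q),
    coverWord W = coverWord W' → W = W'
  | _, _, .nil, .nil, _ => rfl
  | _, _, .nil, .cons _ _, e => by simp [coverWord] at e
  | _, _, .cons _ _, .nil, e => by simp [coverWord] at e
  | p, q, .cons (v := r) h W, .cons (v := s) h' W', e => by
    simp only [coverWord, List.cons.injEq, Prod.mk.injEq, true_and, and_true] at e
    obtain rfl : r = s := Prod.ext e.1 (by rw [h.2, h'.2, e.1])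
    rw [eq_of_coverWord_eq W W' e.2.2]

/-- The end points of a path determine its label, hence its reduced word, hence the path. -/
theorem isAcyclic_coverForest (K : SimpleGraph V) : K.coverForest.IsAcyclic := by
  classical
  refine isAcyclic_iff_subsingleton_path.2 fun p q =>
    ⟨fun W W' => Subtype.ext (eq_of_coverWord_eq _ _ ?_)⟩
  have h := (mk_coverWord W.1).symm.trans (mk_coverWord W'.1)
  have h' := FreeGroup.reduce.sound (mul_left_cancel h)
  rwa [(isReduced_coverWord _ W.2).reduce_eq, (isReduced_coverWord _ W'.2).reduce_eq] at h'

/-- Left multiplication acts on the cover by automorphisms. -/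
def coverTranslate (K : SimpleGraph V) (a : FreeGroup (V × V)) :
    K.coverForest ≃g K.coverForest where
  toFun p := (p.1, a * p.2)
  invFun p := (p.1, a⁻¹ * p.2)
  left_inv p := by simp
  right_inv p := by simp
  map_rel_iff' := by simp [coverForest, mul_assoc]

end SimpleGraph

/-! ### Distances and centres in trees -/

namespace SimpleGraph

variable {W : Type u} {T : SimpleGraph W}

theorem Iso.dist_eq' (φ : T ≃g T) (a b : W) : T.dist (φ a) (φ b) = T.dist a b := by
  have key : ∀ (ψ : T ≃g T) (a b : W), T.Reachable a b → T.dist (ψ a) (ψ b) ≤ T.dist a b := by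
    intro ψ a b h
    obtain ⟨p, hp⟩ := h.exists_walk_length_eq_dist
    rw [← hp, ← Walk.length_map ψ.toHom p]
    exact dist_le _
  by_cases h : T.Reachable a b
  · refine le_antisymm (key φ a b h) ?_
    simpa using key φ.symm (φ a) (φ b) (φ.reachable_iff.2 h)
  · rw [dist_eq_zero_of_not_reachable h,
      dist_eq_zero_of_not_reachable (mt φ.reachable_iff.1 h)]

theorem Reachable.exists_adj_dist {x c : W} (h : T.Reachable x c) (hne : T.dist x c ≠ 0) :
    ∃ y, T.Adj c y ∧ T.dist x y + 1 = T.dist x c := by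
  obtain ⟨p, hp⟩ := h.symm.exists_walk_length_eq_dist
  cases p with
  | nil => simp at hne
  | @cons _ y _ hy p =>
    refine ⟨y, hy, ?_⟩
    rw [Walk.length_cons] at hp
    have h1 := dist_le p
    have h2 := hy.symm.reachable.dist_triangle_right x
    rw [dist_eq_one_iff_adj.2 hy.symm] at h2
    rw [dist_comm (u := x) (v := y)] at *
    rw [dist_comm (u := x) (v := c)] at *
    omega

namespace IsAcyclic

variable (hT : T.IsAcyclic)
include hT

theorem eq_of_dist_add_one {x c y y' : W} (hx : T.Reachable x c) (hy : T.Adj c y)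
    (hy' : T.Adj c y') (h : T.dist x y + 1 = T.dist x c) (h' : T.dist x y' + 1 = T.dist x c) :
    y = y' := by
  have key : ∀ z, T.Adj c z → T.dist x z + 1 = T.dist x c →
      ∃ p : T.Walk c x, p.IsPath ∧ p.snd = z := by
    intro z hz h
    obtain ⟨p, hp⟩ := (hz.symm.reachable.trans hx.symm).exists_walk_length_eq_dist
    refine ⟨.cons hz p, Walk.isPath_of_length_eq_dist _ ?_, by simp⟩
    rw [Walk.length_cons, hp, dist_comm, h, dist_comm]
  obtain ⟨p, hp, rfl⟩ := key y hy h
  obtain ⟨q, hq, rfl⟩ := key y' hy' h'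
  have := hT.subsingleton_path c x
  have h : p = q := congrArg Subtype.val (Subsingleton.elim (α := T.Path c x) ⟨p, hp⟩ ⟨q, hq⟩)
  rw [h]

theorem dist_succ_of_ne {x c y y' : W} (hx : T.Reachable x c) (hy : T.Adj c y)
    (hy' : T.Adj c y') (h : T.dist x y + 1 = T.dist x c) (hne : y' ≠ y) :
    T.dist x y' = T.dist x c + 1 := by
  rcases hT.dist_eq_dist_add_one_of_adj_of_reachable x hy' hx with h1 | h1
  · exact absurd (hT.eq_of_dist_add_one hx hy hy' h h1.symm).symm hne
  · exact h1

/-- The edge from `c` to `y` leads towards `v` and away from `x`, so the geodesics meeting at `c`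
join without backtracking. -/
theorem dist_eq_add {x v : W} : ∀ {c y : W}, T.Adj c y → T.Reachable v c → T.Reachable x c →
    T.dist v y + 1 = T.dist v c → T.dist x y = T.dist x c + 1 →
    T.dist x v = T.dist x c + T.dist v c := by
  intro c y hcy hv hx h1 h2
  induction hn : T.dist v y generalizing c y with
  | zero =>
    have : v = y := ((hv.trans hcy.reachable).dist_eq_zero_iff).1 hn
    subst this
    omega
  | succ n ih =>
    obtain ⟨z, hz, h3⟩ := (hv.trans hcy.reachable).exists_adj_dist (by omega)
    have hzc : z ≠ c := by rintro rfl; omega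
    have h4 := hT.dist_succ_of_ne (hx.trans hcy.reachable) hcy.symm hz h2.symm hzc
    have := ih hz (hv.trans hcy.reachable) (hx.trans hcy.reachable) h3 h4 (by omega)
    omega

/-- The edge `c₀c₁` separates `x₀` from `x₁`, so these adjacent vertices are at distance `2r + 1`.
-/
theorem eq_zero_of_dist {c₀ c₁ x₀ x₁ : W} {r : ℕ} (hc : T.Adj c₀ c₁) (hx : T.Adj x₀ x₁)
    (hr : T.Reachable x₀ c₀) (h00 : T.dist x₀ c₀ = r) (h01 : T.dist x₀ c₁ = r + 1)
    (h11 : T.dist x₁ c₁ = r) (h10 : T.dist x₁ c₀ = r + 1) : r = 0 := by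
  have := hT.dist_eq_add (x := x₀) (v := x₁) hc (hx.symm.reachable.trans hr) hr
    (by omega) (by omega)
  rw [dist_eq_one_iff_adj.2 hx] at this
  omega

theorem even_dist_add_length {a b c : W} (h : T.Reachable a b) (p : T.Walk b c) :
    Even (T.dist a b + T.dist a c + p.length) := by
  induction p with
  | nil => simp
  | cons hbc p ih =>
    have := ih (h.trans hbc.reachable)
    rw [Walk.length_cons]
    rcases hT.dist_eq_dist_add_one_of_adj_of_reachable a hbc h with h1 | h1 <;> grind

theorem even_dist_add {a b c : W} (h : T.Reachable a b) (h' : T.Reachable b c) :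
    Even (T.dist a b + T.dist a c + T.dist b c) := by
  obtain ⟨p, hp⟩ := h'.exists_walk_length_eq_dist
  rw [← hp]
  exact hT.even_dist_add_length h p

end IsAcyclic

/-- `c` is the centre and `r` the radius of the family of points `s`: all points are at distance
at most `r`, with the parity of `r`, and no edge at `c` leads towards all points at distance
`r`. -/
structure IsCenter {ι : Type*} (T : SimpleGraph W) (s : ι → W) (c : W) (r : ℕ) : Prop where
  reachable : ∀ i, T.Reachable (s i) c
  dist_le : ∀ i, T.dist (s i) c ≤ r
  even : ∀ i, Even (T.dist (s i) c + r)
  exists_eq : ∃ i, T.dist (s i) c = r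
  exists_away : ∀ y, T.Adj c y → r ≠ 0 → ∃ i, T.dist (s i) c = r ∧ T.dist (s i) y = r + 1

/-- The centre minimises the largest distance `r`. If an edge at it led towards all points at
distance `r`, its other end would achieve `r - 1`: by parity the remaining points are at distance at
most `r - 2`. -/
theorem IsAcyclic.exists_isCenter {ι : Type*} [Finite ι] [Nonempty ι] (hT : T.IsAcyclic)
    (s : ι → W) (hs : ∀ i j, T.Reachable (s i) (s j)) (he : ∀ i j, Even (T.dist (s i) (s j))) :
    ∃ c r, T.IsCenter s c r := by
  classical
  have hex : ∃ r c, (∀ i, T.Reachable (s i) c) ∧ ∀ i, T.dist (s i) c ≤ r := by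
    obtain ⟨i₀⟩ := ‹Nonempty ι›
    obtain ⟨r, hr⟩ := (Set.finite_range fun i => T.dist (s i) (s i₀)).bddAbove
    exact ⟨r, s i₀, fun i => hs i i₀, fun i => hr ⟨i, rfl⟩⟩
  obtain ⟨c, hc, hr⟩ := Nat.find_spec hex
  have hmin : ∀ r, r < Nat.find hex →
      ¬ ∃ c, (∀ i, T.Reachable (s i) c) ∧ ∀ i, T.dist (s i) c ≤ r :=
    fun r h => Nat.find_min hex h
  generalize Nat.find hex = r at hr hmin
  have hpar : ∀ i j, Even (T.dist (s i) c + T.dist (s j) c) := by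
    intro i j
    have := hT.even_dist_add (hs i j) (hc j)
    have := he i j
    grind
  have hatt : ∃ i, T.dist (s i) c = r := by
    by_contra! h
    obtain ⟨i₀⟩ := ‹Nonempty ι›
    have h1 : ∀ i, T.dist (s i) c < r := fun i => lt_of_le_of_ne (hr i) (h i)
    refine hmin (r - 1) ?_ ⟨c, hc, fun i => ?_⟩
    · have := h1 i₀; omega
    · have := h1 i; omega
  obtain ⟨i₀, hi₀⟩ := hatt
  have heven : ∀ i, Even (T.dist (s i) c + r) := fun i => hi₀ ▸ hpar i i₀
  refine ⟨c, r, hc, hr, heven, ⟨i₀, hi₀⟩, fun y hy hr0 => ?_⟩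
  by_contra! h
  refine hmin (r - 1) (by omega) ⟨y, fun i => (hc i).trans hy.reachable, fun i => ?_⟩
  have h1 := h i
  have h2 := hr i
  have h3 := heven i
  rcases hT.dist_eq_dist_add_one_of_adj_of_reachable (s i) hy (hc i) with h4 | h4
  · omega
  · have : T.dist (s i) c ≠ r := fun e => h1 e (by omega)
    grind

namespace IsCenter

variable {ι : Type*} {s s' : ι → W} {c c' : W} {r r' : ℕ}

theorem map (h : T.IsCenter s c r) (φ : T ≃g T) : T.IsCenter (fun i => φ (s i)) (φ c) r where
  reachable i := φ.reachable_iff.2 (h.reachable i)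
  dist_le i := by rw [Iso.dist_eq']; exact h.dist_le i
  even i := by rw [Iso.dist_eq']; exact h.even i
  exists_eq := by simpa only [Iso.dist_eq'] using h.exists_eq
  exists_away y hy hr := by
    obtain ⟨i, h1, h2⟩ := h.exists_away (φ.symm y) (by simpa using φ.symm.map_adj_iff.2 hy) hr
    refine ⟨i, by rwa [Iso.dist_eq'], ?_⟩
    rw [← h2, ← Iso.dist_eq' φ (s i), RelIso.apply_symm_apply]

/-- Some farthest point lies beyond the centre as seen from `v`. -/
theorem exists_dist_eq (hT : T.IsAcyclic) (h : T.IsCenter s c r) {v : W} (hv : T.Reachable v c) :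
    ∃ i, T.dist (s i) v = r + T.dist v c := by
  by_cases hd : T.dist v c = 0
  · obtain rfl := hv.dist_eq_zero_iff.1 hd
    simpa using h.exists_eq
  rcases Nat.eq_zero_or_pos r with rfl | hr
  · obtain ⟨i, hi⟩ := h.exists_eq
    obtain rfl := ((h.reachable i).dist_eq_zero_iff.1 hi)
    exact ⟨i, by rw [dist_comm, zero_add]⟩
  · obtain ⟨y, hy, h1⟩ := hv.exists_adj_dist hd
    obtain ⟨i, h2, h3⟩ := h.exists_away y hy hr.ne'
    exact ⟨i, by rw [hT.dist_eq_add hy hv (h.reachable i) h1 (by omega), h2]⟩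

/-- A farthest point seen from the other centre has a neighbour in the other family. This bounds `r
+ dist c c'` by `r' + 1`, and symmetrically, so `dist c c' ≤ 1`. Parity excludes equal radii at a
common centre. -/
theorem eq_or_adj [Nonempty ι] (hT : T.IsAcyclic) (h : T.IsCenter s c r)
    (h' : T.IsCenter s' c' r')
    (hs : ∀ i, ∃ j, T.Adj (s i) (s' j)) (hs' : ∀ j, ∃ i, T.Adj (s i) (s' j)) :
    (c = c' ∧ (r' = r + 1 ∨ r = r' + 1)) ∨ (T.Adj c c' ∧ r = r') := by
  have hcc : T.Reachable c c' := by
    obtain ⟨i⟩ := ‹Nonempty ι›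
    obtain ⟨j, hj⟩ := hs i
    exact (h.reachable i).symm.trans (hj.reachable.trans (h'.reachable j))
  have key1 : r + T.dist c c' ≤ r' + 1 := by
    obtain ⟨i, hi⟩ := h.exists_dist_eq hT hcc.symm
    obtain ⟨j, hj⟩ := hs i
    have h1 := hj.reachable.dist_triangle_left c'
    rw [dist_eq_one_iff_adj.2 hj, hi, dist_comm] at h1
    have := h'.dist_le j
    omega
  have key2 : r' + T.dist c c' ≤ r + 1 := by
    obtain ⟨j, hj⟩ := h'.exists_dist_eq hT hcc
    obtain ⟨i, hi⟩ := hs' j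
    have h1 := hi.symm.reachable.dist_triangle_left c
    rw [dist_eq_one_iff_adj.2 hi.symm, hj] at h1
    have := h.dist_le i
    omega
  by_cases hd : T.dist c c' = 0
  · obtain rfl := hcc.dist_eq_zero_iff.1 hd
    refine Or.inl ⟨rfl, ?_⟩
    obtain ⟨i⟩ := ‹Nonempty ι›
    obtain ⟨j, hj⟩ := hs i
    have h1 := h.even i
    have h2 := h'.even j
    have h3 := hT.dist_eq_dist_add_one_of_adj_of_reachable c hj (h.reachable i).symm
    rw [dist_comm (u := c), dist_comm (u := c)] at h3
    grind
  · exact Or.inr ⟨dist_eq_one_iff_adj.1 (by omega), by omega⟩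

end IsCenter

end SimpleGraph

/-! ### Lifted slices and the homomorphism built from their centres -/

namespace SimpleGraph

variable {V : Type u} {K : SimpleGraph V}

/-- The vertex of the cover reached from `p` by the dart to `x`. -/
def coverStep (p : V × FreeGroup (V × V)) (x : V) : V × FreeGroup (V × V) :=
  (x, p.2 * dartLabel p.1 x)

theorem adj_coverStep {p : V × FreeGroup (V × V)} {x : V} (h : K.Adj p.1 x) :
    K.coverForest.Adj p (coverStep p x) := ⟨h, rfl⟩

theorem eq_coverStep {p q : V × FreeGroup (V × V)} (h : K.coverForest.Adj p q) :
    q = coverStep p q.1 := Prod.ext rfl h.2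

theorem coverTranslate_coverStep (a : FreeGroup (V × V)) (p : V × FreeGroup (V × V)) (x : V) :
    K.coverTranslate a (coverStep p x) = coverStep (K.coverTranslate a p) x :=
  Prod.ext rfl (mul_assoc _ _ _).symm

@[simp] theorem coverTranslate_fst (a : FreeGroup (V × V)) (p : V × FreeGroup (V × V)) :
    (K.coverTranslate a p).1 = p.1 := rfl

variable {X : Type v} {Y : Type w}

/-- A family of lifts of the slices `{g} × H` to the cover, such that the lifts over adjacent
vertices are adjacent after a translation. -/
structure SliceLift (G : SimpleGraph X) (H : SimpleGraph Y) (K : SimpleGraph V) where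
  /-- the lifts -/
  pt : X → Y → V × FreeGroup (V × V)
  /-- the translations -/
  shift : X → X → FreeGroup (V × V)
  adj : ∀ {g g' h h'}, G.Adj g g' → H.Adj h h' →
    K.coverForest.Adj (pt g h) (K.coverTranslate (shift g g') (pt g' h'))

namespace SliceLift

variable {G : SimpleGraph X} {H : SimpleGraph Y} (S : SliceLift G H K)

/-- Going over the edge `gg'` and back cancels the translation, so even walks of `H` lift between
points of one slice. -/
theorem exists_walk {g g' : X} (hg : G.Adj g g') {h h' : Y} (p : H.Walk h h') :
    (Even p.length →
      ∃ q : K.coverForest.Walk (S.pt g h) (S.pt g h'), q.length = p.length) ∧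
    (¬ Even p.length →
      ∃ q : K.coverForest.Walk (K.coverTranslate (S.shift g g') (S.pt g' h)) (S.pt g h'),
        q.length = p.length) := by
  induction p with
  | nil => exact ⟨fun _ => ⟨.nil, rfl⟩, fun h => absurd (by simp) h⟩
  | @cons h h₁ h' hh p ih =>
    rw [Walk.length_cons, Nat.even_add_one]
    refine ⟨fun he => ?_, fun he => ?_⟩
    · obtain ⟨q, hq⟩ := ih.2 he
      exact ⟨.cons (S.adj hg hh) q, by simp [hq]⟩
    · obtain ⟨q, hq⟩ := ih.1 (not_not.1 he)
      exact ⟨.cons (S.adj hg hh.symm).symm q, by simp [hq]⟩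

variable {S} {c : X → V × FreeGroup (V × V)} {r : X → ℕ}
  (hc : ∀ g, K.coverForest.IsCenter (S.pt g) (c g) (r g))

include hc

theorem center_cases [Nonempty Y] (hH : ∀ h, ∃ h', H.Adj h h') {g g' : X} (hg : G.Adj g g') :
    ((c g).1 = (c g').1 ∧ (r g' = r g + 1 ∨ r g = r g' + 1)) ∨
      (K.coverForest.Adj (c g) (K.coverTranslate (S.shift g g') (c g')) ∧ r g = r g') := by
  rcases (hc g).eq_or_adj K.isAcyclic_coverForest ((hc g').map (K.coverTranslate (S.shift g g')))
    (fun i => (hH i).imp fun j hj => S.adj hg hj)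
    (fun i => (hH i).imp fun j hj => S.adj hg hj.symm) with h | h
  · have h1 := congrArg Prod.fst h.1
    exact Or.inl ⟨h1, h.2⟩
  · exact Or.inr h

/-- Otherwise the edge joining the two centres would separate two adjacent farthest points, against
`eq_zero_of_dist`. -/
theorem toward_of_away {g g' : X} (hg : G.Adj g g')
    (hcc : K.coverForest.Adj (c g) (K.coverTranslate (S.shift g g') (c g'))) (hr : r g = r g')
    (hr0 : r g ≠ 0) {h h' : Y} (hh : H.Adj h h') (h1 : K.coverForest.dist (S.pt g h) (c g) = r g)
    (h2 : K.coverForest.dist (S.pt g h) (coverStep (c g) (c g').1) = r g + 1) :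
    K.coverForest.dist (S.pt g' h') (c g') = r g' ∧
      K.coverForest.dist (S.pt g' h') (coverStep (c g') (c g).1) + 1 = r g' := by
  set φ := K.coverTranslate (S.shift g g')
  have hx : K.coverForest.Adj (S.pt g h) (φ (S.pt g' h')) := S.adj hg hh
  have hT := K.isAcyclic_coverForest
  have e1 : coverStep (c g) (c g').1 = φ (c g') := (eq_coverStep hcc).symm
  have e2 : φ (coverStep (c g') (c g).1) = c g := by
    rw [coverTranslate_coverStep]
    exact (eq_coverStep hcc.symm).symm
  rw [e1] at h2
  have h3 := (hc g').dist_le h'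
  rw [← Iso.dist_eq' φ] at h3
  rw [← Iso.dist_eq' φ, ← Iso.dist_eq' φ _ (coverStep _ _), e2]
  have hreach := (hc g).reachable h
  have h4 := hT.dist_eq_dist_add_one_of_adj_of_reachable (φ (c g')) hx
    (hreach.trans hcc.reachable).symm
  have h5 := hT.dist_eq_dist_add_one_of_adj_of_reachable (c g) hx hreach.symm
  rw [dist_comm (u := φ (c g')), dist_comm (u := φ (c g'))] at h4
  rw [dist_comm (u := c g), dist_comm (u := c g)] at h5
  have h6 : K.coverForest.dist (φ (S.pt g' h')) (φ (c g')) = r g := by omega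
  refine ⟨h6.trans hr, ?_⟩
  rcases h5 with h5 | h5
  · omega
  · exact absurd (hT.eq_zero_of_dist hcc hx hreach h1 h2 h6 (by omega)) hr0

omit hc

/-- `LongDir c r n g x` says that some walk of length `n` starting at `g` along which `r` is
constant has an image under the centre map which starts towards `x` and never backtracks. -/
def LongDir (G : SimpleGraph X) (K : SimpleGraph V) (c : X → V × FreeGroup (V × V)) (r : X → ℕ) :
    ℕ → X → V → Prop
  | 0, _, _ => True
  | n + 1, g, x => ∃ g', G.Adj g g' ∧ r g = r g' ∧ (c g').1 = x ∧
      ∃ y, y ≠ (c g).1 ∧ K.Adj x y ∧ LongDir G K c r n g' y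

include hc

/-- Each step turns a farthest point away from the next centre into one towards the previous centre.
The end `g'` and the direction `y` are chosen before the walk in `H`, which may then be arbitrary of
the given length. -/
theorem LongDir.toward [Nonempty Y] (hH : ∀ h, ∃ h', H.Adj h h') {n : ℕ} {g : X} {x : V}
    (hr : r g ≠ 0) (hL : LongDir G K c r (n + 1) g x) :
    ∃ g' y, K.Adj (c g').1 y ∧ r g' ≠ 0 ∧ ∀ h h' (p : H.Walk h h'), p.length = n + 1 →
      K.coverForest.dist (S.pt g h) (c g) = r g →
      K.coverForest.dist (S.pt g h) (coverStep (c g) x) = r g + 1 →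
      K.coverForest.dist (S.pt g' h') (coverStep (c g') y) + 1 = r g' := by
  induction n generalizing g x with
  | zero =>
    obtain ⟨g', hg, hrr, rfl, -⟩ := hL
    have hcc : K.coverForest.Adj (c g) (K.coverTranslate (S.shift g g') (c g')) := by
      rcases center_cases hc hH hg with h | h
      · omega
      · exact h.1
    refine ⟨g', (c g).1, hcc.1.symm, hrr ▸ hr, fun h h' p hp h1 h2 => ?_⟩
    exact (toward_of_away hc hg hcc hrr hr (Walk.adj_of_length_eq_one hp) h1 h2).2
  | succ n ih =>
    obtain ⟨g', hg, hrr, rfl, y, hy, hxy, hL⟩ := hL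
    have hcc : K.coverForest.Adj (c g) (K.coverTranslate (S.shift g g') (c g')) := by
      rcases center_cases hc hH hg with h | h
      · omega
      · exact h.1
    obtain ⟨g'', z, hz, hr'', h3⟩ := ih (hrr ▸ hr) hL
    refine ⟨g'', z, hz, hr'', fun h h' p hp h1 h2 => ?_⟩
    cases p with
    | nil => simp at hp
    | @cons _ h₁ _ hh p =>
      obtain ⟨h4, h5⟩ := toward_of_away hc hg hcc hrr hr hh h1 h2
      -- The point lies towards the previous centre; as `y` is another direction, it lies away from
      -- `y`.
      refine h3 h₁ h' p (by simpa using hp) h4 ?_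
      rw [← h4] at h5 ⊢
      refine K.isAcyclic_coverForest.dist_succ_of_ne ((hc g').reachable h₁)
        (adj_coverStep hcc.1.symm) (adj_coverStep hxy) h5 fun e => hy (congrArg Prod.fst e)

/-- A walk in `H` can be aimed at a farthest point away from `y` in the last slice, whereas
`LongDir.toward` puts its end towards `y`. -/
theorem not_longDir [Nonempty Y] (hH : ∀ h, ∃ h', H.Adj h h') {N : ℕ}
    (hN : ∀ h h', ∃ p : H.Walk h h', p.length = N + 1) {g : X} {x : V} (hx : K.Adj (c g).1 x)
    (hr : r g ≠ 0) : ¬ LongDir G K c r (N + 1) g x := by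
  intro hL
  obtain ⟨g', y, hy, hr', h1⟩ := LongDir.toward hc hH hr hL
  obtain ⟨h, h2, h3⟩ := (hc g).exists_away _ (adj_coverStep hx) hr
  obtain ⟨h', h4, h5⟩ := (hc g').exists_away _ (adj_coverStep hy) hr'
  obtain ⟨p, hp⟩ := hN h h'
  have := h1 h h' p hp h2 h3
  omega

omit hc

theorem mapsTo [Finite Y] [Nonempty Y] (S : SliceLift G H K) (hG : ∀ g, ∃ g', G.Adj g g')
    (hH : ∀ h, ∃ h', H.Adj h h') {N : ℕ}
    (hN : ∀ h h', ∃ p : H.Walk h h', p.length = 2 * N + 2) : G.MapsTo K := by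
  classical
  have hT := K.isAcyclic_coverForest
  have hex : ∀ g, ∃ c r, K.coverForest.IsCenter (S.pt g) c r := by
    intro g
    obtain ⟨g', hg⟩ := hG g
    have key : ∀ h h', ∃ q : K.coverForest.Walk (S.pt g h) (S.pt g h'), Even q.length := by
      intro h h'
      obtain ⟨p, hp⟩ := hN h h'
      have he : Even p.length := hp ▸ ⟨N + 1, by ring⟩
      obtain ⟨q, hq⟩ := (S.exists_walk hg p).1 he
      exact ⟨q, hq ▸ he⟩
    refine hT.exists_isCenter _ (fun h h' => (key h h').choose.reachable) fun h h' => ?_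
    obtain ⟨q, hq⟩ := key h h'
    have := hT.even_dist_add_length (Reachable.refl _) q
    simp only [dist_self, zero_add] at this
    exact (Nat.even_add.1 this).2 hq
  choose c r hc using hex
  have hnbr : ∀ g, r g ≠ 0 → ∃ x, K.Adj (c g).1 x := by
    intro g hr
    obtain ⟨i, hi⟩ := (hc g).exists_eq
    obtain ⟨y, hy, -⟩ := ((hc g).reachable i).exists_adj_dist (by omega)
    exact ⟨y.1, hy.1⟩
  -- Non-backtracking routes have bounded length by `not_longDir`, so a longest one exists; `x` is
  -- its first direction.
  have hmax : ∀ g, r g ≠ 0 → ∃ n x, K.Adj (c g).1 x ∧ LongDir G K c r n g x ∧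
      ∀ x', K.Adj (c g).1 x' → ¬ LongDir G K c r (n + 1) g x' := by
    intro g hr
    by_contra! hcon
    have : ∀ n, ∃ x, K.Adj (c g).1 x ∧ LongDir G K c r n g x := by
      intro n
      induction n with
      | zero => exact (hnbr g hr).imp fun x hx => ⟨hx, trivial⟩
      | succ n ih =>
        obtain ⟨x, hx, hL⟩ := ih
        exact hcon n x hx hL
    obtain ⟨x, hx, hL⟩ := this (2 * N + 1 + 1)
    exact not_longDir hc hH hN hx hr hL
  rcases isEmpty_or_nonempty X with hX | ⟨⟨g₀⟩⟩
  · exact ⟨⟨isEmptyElim, fun {g} => isEmptyElim g⟩⟩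
  have : Nonempty V := ⟨(c g₀).1⟩
  choose! n f hf hL hn using hmax
  -- If the centre is kept, the radius changes parity, and exactly one of the two images is moved
  -- off the centre. Only two equal odd radii need the choice of `f`.
  let F : X → V := fun g => if Even (r g) then (c g).1 else f g
  refine ⟨⟨F, fun {g g'} hg => ?_⟩⟩
  have hr0 : ∀ g, ¬ Even (r g) → r g ≠ 0 := fun g h e => h (by simp [e])
  rcases center_cases hc hH hg with ⟨h1, h2⟩ | ⟨h1, h2⟩
  · by_cases he : Even (r g)
    · have he' : ¬ Even (r g') := by grind
      simp only [F, if_pos he, if_neg he']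
      rw [h1]
      exact hf g' (hr0 g' he')
    · have he' : Even (r g') := by grind
      simp only [F, if_neg he, if_pos he']
      rw [← h1]
      exact (hf g (hr0 g he)).symm
  · by_cases he : Even (r g)
    · have he' : Even (r g') := h2 ▸ he
      simp only [F, if_pos he, if_pos he']
      exact h1.1
    · have he' : ¬ Even (r g') := h2 ▸ he
      simp only [F, if_neg he, if_neg he']
      have hadj : K.Adj (c g).1 (c g').1 := h1.1
      by_cases e1 : f g = (c g').1
      · rw [e1]
        exact hf g' (hr0 g' he')
      by_cases e2 : f g' = (c g).1
      · rw [e2]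
        exact (hf g (hr0 g he)).symm
      -- Unless `f b` points back to the centre of `a`, the step from `a` to `b` extends a longest
      -- route from `b`. This cannot hold in both directions.
      have h3 : ∀ a b, G.Adj a b → r a = r b → r b ≠ 0 → K.Adj (c a).1 (c b).1 →
          f b ≠ (c a).1 → n b + 1 ≤ n a := by
        intro a b hab hr hrb hK hfb
        by_contra! hlt
        have hmono : ∀ m k b y, LongDir G K c r (m + k) b y → LongDir G K c r m b y := by
          intro m k
          induction m with
          | zero => intros; trivial
          | succ m ih =>
            rintro b y h
            rw [Nat.add_right_comm] at h
            obtain ⟨g', h1, h2, h3, y, h4, h5, h6⟩ := h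
            exact ⟨g', h1, h2, h3, y, h4, h5, ih _ _ h6⟩
        obtain ⟨k, hk⟩ := Nat.exists_eq_add_of_le (Nat.lt_succ_iff.1 hlt)
        refine hn a (hr ▸ hrb) _ hK ⟨b, hab, hr, rfl, f b, hfb, hf b hrb, ?_⟩
        exact hmono _ k _ _ (hk ▸ hL b hrb)
      have h4 := h3 g g' hg h2 (hr0 g' he') hadj e2
      have h5 := h3 g' g hg.symm h2.symm (hr0 g he) hadj.symm e1
      omega

end SliceLift

end SimpleGraph

/-! ### Labels of walks in a tensor product -/

namespace SimpleGraph

variable {X : Type v} {Y : Type w}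

/-- The first projection of a tensor product. -/
def tensorFst (G : SimpleGraph X) (H : SimpleGraph Y) : G.tensorProd H →g G := ⟨Prod.fst, And.left⟩

/-- The second projection of a tensor product. -/
def tensorSnd (G : SimpleGraph X) (H : SimpleGraph Y) : G.tensorProd H →g H := ⟨Prod.snd, And.right⟩

/-- The projection of a walk in a tensor product to the first factor. -/
def fstWalk {G : SimpleGraph X} {H : SimpleGraph Y} {p q : X × Y}
    (P : (G.tensorProd H).Walk p q) : G.Walk p.1 q.1 := P.map (tensorFst G H)

/-- The projection of a walk in a tensor product to the second factor. -/
def sndWalk {G : SimpleGraph X} {H : SimpleGraph Y} {p q : X × Y}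
    (P : (G.tensorProd H).Walk p q) : H.Walk p.2 q.2 := P.map (tensorSnd G H)

@[simp] theorem length_fstWalk {G : SimpleGraph X} {H : SimpleGraph Y} {p q : X × Y}
    (P : (G.tensorProd H).Walk p q) : (fstWalk P).length = P.length := Walk.length_map _ _

@[simp] theorem length_sndWalk {G : SimpleGraph X} {H : SimpleGraph Y} {p q : X × Y}
    (P : (G.tensorProd H).Walk p q) : (sndWalk P).length = P.length := Walk.length_map _ _

/-- A labelling of the darts of `G × H` by a group for which backtracking and going around
a four-cycle whose projection to one of the factors is a path are trivial. -/
structure ProdWeight (G : SimpleGraph X) (H : SimpleGraph Y) (F : Type*) [Group F] where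
  /-- the label of the dart from `(g, h)` to `(g', h')` -/
  wt : X → Y → X → Y → F
  mul_symm : ∀ {g g' h h'}, G.Adj g g' → H.Adj h h' → wt g h g' h' * wt g' h' g h = 1
  sq_left : ∀ {g₀ g₁ g₂ h h₁ h₂}, G.Adj g₀ g₁ → G.Adj g₁ g₂ → H.Adj h h₁ → H.Adj h h₂ →
    wt g₀ h g₁ h₁ * wt g₁ h₁ g₂ h = wt g₀ h g₁ h₂ * wt g₁ h₂ g₂ h
  sq_right : ∀ {g g₁ g₂ h₀ h₁ h₂}, G.Adj g g₁ → G.Adj g g₂ → H.Adj h₀ h₁ → H.Adj h₁ h₂ →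
    wt g h₀ g₁ h₁ * wt g₁ h₁ g h₂ = wt g h₀ g₂ h₁ * wt g₂ h₁ g h₂

namespace ProdWeight

variable {G : SimpleGraph X} {H : SimpleGraph Y} {F : Type*} [Group F] (w : ProdWeight G H F)

/-- The same labelling with the two factors exchanged. -/
def swap : ProdWeight H G F where
  wt h g h' g' := w.wt g h g' h'
  mul_symm a b := w.mul_symm b a
  sq_left a b c d := w.sq_right c d a b
  sq_right a b c d := w.sq_left c d a b

/-- The label of the walk over `p` whose second coordinate alternates between `h` and `h₁`. -/
def alt : Y → Y → {g g' : X} → G.Walk g g' → F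
  | _, _, _, _, .nil => 1
  | h, h₁, g, _, .cons (v := g₁) _ p => w.wt g h g₁ h₁ * alt h₁ h p

/-- The label of a walk in the tensor product. -/
def val : {p q : X × Y} → (G.tensorProd H).Walk p q → F
  | _, _, .nil => 1
  | p, _, .cons (v := r) _ P => w.wt p.1 p.2 r.1 r.2 * val P

@[simp] theorem alt_nil (h h₁ : Y) (g : X) : w.alt h h₁ (.nil : G.Walk g g) = 1 := rfl

@[simp] theorem alt_cons (h h₁ : Y) {g g₁ g' : X} (hg : G.Adj g g₁) (p : G.Walk g₁ g') :
    w.alt h h₁ (.cons hg p) = w.wt g h g₁ h₁ * w.alt h₁ h p := rfl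

theorem alt_append {g g' g'' : X} (p : G.Walk g g') (q : G.Walk g' g'') (h h₁ : Y) :
    w.alt h h₁ (p.append q) =
      w.alt h h₁ p * if Even p.length then w.alt h h₁ q else w.alt h₁ h q := by
  induction p generalizing h h₁ with
  | nil => simp
  | cons hg p ih =>
    rw [Walk.cons_append, alt_cons, ih, alt_cons, mul_assoc]
    by_cases he : Even p.length <;> simp [he, Nat.even_add_one]

theorem alt_reverse {g g' : X} (p : G.Walk g g') {h h₁ : Y} (hh : H.Adj h h₁) :
    (if Even p.length then w.alt h h₁ p.reverse else w.alt h₁ h p.reverse) =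
      (w.alt h h₁ p)⁻¹ := by
  induction p generalizing h h₁ with
  | nil => simp
  | @cons g g₁ g' hg p ih =>
    have h1 := ih hh.symm
    rw [Walk.reverse_cons, alt_append, alt_append, w.alt_cons h h₁ hg p, mul_inv_rev, ← h1,
      inv_eq_of_mul_eq_one_right (w.mul_symm hg hh)]
    by_cases he : Even p.length <;> simp [he, Nat.even_add_one]

theorem alt_reverse_even {g g' : X} {p : G.Walk g g'} (hp : Even p.length) {h h₁ : Y}
    (hh : H.Adj h h₁) : w.alt h h₁ p.reverse = (w.alt h h₁ p)⁻¹ := by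
  simpa [hp] using w.alt_reverse p hh

theorem alt_append_even {g g' g'' : X} {p : G.Walk g g'} (hp : Even p.length)
    (q : G.Walk g' g'') (h h₁ : Y) : w.alt h h₁ (p.append q) = w.alt h h₁ p * w.alt h h₁ q := by
  simp [alt_append, hp]

theorem alt_append_odd {g g' g'' : X} {p : G.Walk g g'} (hp : ¬ Even p.length)
    (q : G.Walk g' g'') (h h₁ : Y) : w.alt h h₁ (p.append q) = w.alt h h₁ p * w.alt h₁ h q := by
  simp [alt_append, hp]

theorem even_of_cons_cons {g g₁ g₂ g' : X} {hg : G.Adj g g₁} {hg' : G.Adj g₁ g₂}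
    {p : G.Walk g₂ g'} (hp : Even (Walk.cons hg (.cons hg' p)).length) : Even p.length := by
  simpa [Nat.even_add_one] using hp

theorem alt_congr {h h₁ h₂ : Y} (hh : H.Adj h h₁) (hh' : H.Adj h h₂) :
    ∀ {g g' : X} (p : G.Walk g g'), Even p.length → w.alt h h₁ p = w.alt h h₂ p
  | _, _, .nil, _ => rfl
  | _, _, .cons _ .nil, hp => by simp at hp
  | _, _, .cons hg (.cons hg' p), hp => by
    simp only [alt_cons, ← mul_assoc]
    rw [w.sq_left hg hg' hh hh', alt_congr hh hh' p (even_of_cons_cons hp)]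

/-- Slides an even walk over `G` across two steps of `H`, square by square. -/
theorem alt_mul_step {h₀ h₁ h₂ : Y} (hh : H.Adj h₀ h₁) (hh' : H.Adj h₁ h₂) :
    ∀ {g g' : X} (p : G.Walk g g'), Even p.length → ∀ {a b : X}, G.Adj g a → G.Adj g' b →
      w.alt h₀ h₁ p * (w.wt g' h₀ b h₁ * w.wt b h₁ g' h₂) =
        w.wt g h₀ a h₁ * w.wt a h₁ g h₂ * w.alt h₂ h₁ p
  | _, _, .nil, _, _, _, ha, hb => by simp [w.sq_right ha hb hh hh']
  | _, _, .cons _ .nil, hp, _, _, _, _ => by simp at hp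
  | g, g', .cons (v := k) hg (.cons (v := l) hg' p), hp, a, b, ha, hb => by
    have ih := alt_mul_step hh hh' p (even_of_cons_cons hp) hg'.symm hb
    simp only [alt_cons, mul_assoc] at ih ⊢
    have e1 : w.wt g h₀ a h₁ * (w.wt a h₁ g h₂ *
        (w.wt g h₂ k h₁ * (w.wt k h₁ l h₂ * w.alt h₂ h₁ p))) =
        w.wt g h₀ k h₁ * w.wt k h₁ g h₂ * (w.wt g h₂ k h₁ * (w.wt k h₁ l h₂ * w.alt h₂ h₁ p)) := by
      rw [← w.sq_right ha hg hh hh', mul_assoc]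
    rw [ih, e1]
    simp only [← mul_assoc]
    rw [mul_assoc _ _ (w.wt l h₀ k h₁), w.mul_symm hg' hh.symm, mul_assoc _ _ (w.wt g h₂ k h₁),
      w.mul_symm hg.symm hh']

/-- The two sides are the labels of the two ways around the rectangle spanned by `p` and `q`. For
closed walks, and with matching auxiliary neighbours, this is commutation. -/
theorem alt_mul_alt_swap {g g' : X} {p : G.Walk g g'} (hp : Even p.length) {a b : X}
    (ha : G.Adj g a) (hb : G.Adj g' b) : ∀ {h h' : Y} (q : H.Walk h h'), Even q.length →
    ∀ {h₁ h₁' : Y}, H.Adj h h₁ → H.Adj h' h₁' →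
      w.alt h h₁ p * w.swap.alt g' b q = w.swap.alt g a q * w.alt h' h₁' p
  | _, _, .nil, _, _, _, hh, hh' => by simp [w.alt_congr hh hh' p hp]
  | _, _, .cons _ .nil, hq, _, _, _, _ => by simp at hq
  | h, h', .cons (v := k) hk (.cons (v := l) hl q), hq, h₁, h₁', hh, hh' => by
    have ih := alt_mul_alt_swap hp ha hb q (even_of_cons_cons hq) hl.symm hh'
    have h1 := w.alt_mul_step hk hl p hp ha hb
    simp only [alt_cons, mul_assoc]
    rw [← ih]
    simp only [← mul_assoc]
    rw [w.alt_congr hh hk p hp]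
    simp only [← mul_assoc] at h1
    change _ * w.wt g' h b k * w.wt b k g' l * _ = w.wt g h a k * w.wt a k g l * _ * _
    rw [h1]

theorem val_append {p q r : X × Y} (P : (G.tensorProd H).Walk p q)
    (Q : (G.tensorProd H).Walk q r) : w.val (P.append Q) = w.val P * w.val Q := by
  induction P with
  | nil => simp [val]
  | cons h P ih => simp only [Walk.cons_append, val, ih, mul_assoc]

/-- Up to squares, all motion in `G` can be done first and all motion in `H` afterwards. -/
theorem val_eq : ∀ {p q : X × Y} (P : (G.tensorProd H).Walk p q), Even P.length →
    ∀ {h₁ : Y} {a : X}, H.Adj p.2 h₁ → G.Adj q.1 a →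
      w.val P = w.alt p.2 h₁ (fstWalk P) * w.swap.alt q.1 a (sndWalk P)
  | _, _, .nil, _, _, _, _, _ => (mul_one (1 : F)).symm
  | _, _, .cons _ .nil, hP, _, _, _, _ => by simp at hP
  | p, q, .cons (v := k) hk (.cons (v := l) hl P), hP, h₁, a, hh, ha => by
    have hP' := even_of_cons_cons hP
    have ih := val_eq P hP' hl.2.symm ha
    rw [w.alt_congr hh hk.2 _ (by rwa [length_fstWalk])]
    have hA : Even (fstWalk P).length := by rwa [length_fstWalk]
    let A := fstWalk P
    let B := sndWalk P
    change w.val P = w.alt l.2 k.2 A * w.swap.alt q.1 a B at ih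
    have h1 : w.alt p.2 k.2 A * (w.wt q.1 p.2 a k.2 * w.wt a k.2 q.1 l.2) = _ :=
      w.alt_mul_step hk.2 hl.2 A hA hl.1.symm ha
    change w.wt p.1 p.2 k.1 k.2 * (w.wt k.1 k.2 l.1 l.2 * w.val P) =
      w.wt p.1 p.2 k.1 k.2 * (w.wt k.1 k.2 l.1 p.2 * w.alt p.2 k.2 A) *
        (w.wt q.1 p.2 a k.2 * (w.wt a k.2 q.1 l.2 * w.swap.alt q.1 a B))
    calc _ = w.wt p.1 p.2 k.1 k.2 * (w.wt k.1 k.2 l.1 p.2 * w.wt l.1 p.2 k.1 k.2) *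
          (w.wt k.1 k.2 l.1 l.2 * w.val P) := by rw [w.mul_symm hl.1 hk.2.symm, mul_one]
      _ = w.wt p.1 p.2 k.1 k.2 * w.wt k.1 k.2 l.1 p.2 *
          (w.wt l.1 p.2 k.1 k.2 * w.wt k.1 k.2 l.1 l.2 * w.alt l.2 k.2 A) *
            w.swap.alt q.1 a B := by rw [ih]; simp only [mul_assoc]
      _ = _ := by rw [← h1]; simp only [mul_assoc]

end ProdWeight

end SimpleGraph

/-! ### Non-bipartite factors, and the case of trivial labels -/

namespace SimpleGraph

variable {X : Type v} {Y : Type w} {G : SimpleGraph X} {H : SimpleGraph Y}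

/-- Every two vertices are joined by walks of both parities. -/
def IsOddConnected (G : SimpleGraph X) : Prop :=
  ∀ u v, (∃ p : G.Walk u v, Even p.length) ∧ ∃ p : G.Walk u v, ¬ Even p.length

theorem Connected.isOddConnected (hG : G.Connected) (h2 : ¬ G.Colorable 2) :
    G.IsOddConnected := by
  rw [two_colorable_iff_forall_loop_even] at h2
  push Not at h2
  obtain ⟨z, c, hc⟩ := h2
  intro u v
  obtain ⟨p⟩ := hG.preconnected u z
  obtain ⟨q⟩ := hG.preconnected z v
  by_cases he : Even (p.append q).length
  · refine ⟨⟨_, he⟩, p.append (c.append q), ?_⟩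
    simp only [Walk.length_append] at he ⊢
    grind
  · refine ⟨⟨p.append (c.append q), ?_⟩, _, he⟩
    simp only [Walk.length_append] at he ⊢
    grind

namespace IsOddConnected

theorem exists_adj (hG : G.IsOddConnected) (g : X) : ∃ g', G.Adj g g' := by
  obtain ⟨-, p, hp⟩ := hG g g
  cases p with
  | nil => simp at hp
  | @cons _ g' _ h p => exact ⟨g', h⟩

theorem exists_length_add (hG : G.IsOddConnected) {g g' : X} (p : G.Walk g g') (k : ℕ) :
    ∃ q : G.Walk g g', q.length = p.length + 2 * k := by
  induction k with
  | zero => exact ⟨p, rfl⟩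
  | succ k ih =>
    obtain ⟨q, hq⟩ := ih
    obtain ⟨a, ha⟩ := hG.exists_adj g
    exact ⟨.cons ha (.cons ha.symm q), by simp only [Walk.length_cons, hq]; ring⟩

theorem exists_uniform_length [Finite X] (hG : G.IsOddConnected) :
    ∃ N, ∀ g g', ∃ p : G.Walk g g', p.length = 2 * N + 2 := by
  choose p hp using fun g g' => (hG g g').1
  obtain ⟨N, hN⟩ := (Set.finite_range fun x : X × X => (p x.1 x.2).length).bddAbove
  refine ⟨N, fun g g' => ?_⟩
  have h1 : (p g g').length ≤ N := hN ⟨(g, g'), rfl⟩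
  obtain ⟨m, hm⟩ := hp g g'
  obtain ⟨q, hq⟩ := hG.exists_length_add (p g g') (N + 1 - m)
  exact ⟨q, by omega⟩

end IsOddConnected

theorem exists_tensorProd_walk_of_length_eq {g g' : X} (p : G.Walk g g') {h h' : Y}
    (q : H.Walk h h') (hpq : p.length = q.length) :
    ∃ r : (G.tensorProd H).Walk (g, h) (g', h'), r.length = p.length := by
  induction p generalizing h with
  | nil =>
    cases q with
    | nil => exact ⟨.nil, rfl⟩
    | cons => simp at hpq
  | @cons g g₁ g' hg p ih =>
    cases q with
    | nil => simp at hpq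
    | @cons _ h₁ _ hh q =>
      obtain ⟨r, hr⟩ := ih q (by simpa using hpq)
      exact ⟨.cons (v := (g₁, h₁)) ⟨hg, hh⟩ r, congrArg (· + 1) hr⟩

theorem IsOddConnected.tensorProd (hG : G.IsOddConnected) (hH : H.IsOddConnected) :
    (G.tensorProd H).IsOddConnected := by
  have key : ∀ {g g' : X} (p : G.Walk g g') {h h' : Y} (q : H.Walk h h'),
      (Even p.length ↔ Even q.length) →
      ∃ r : (G.tensorProd H).Walk (g, h) (g', h'), Even r.length ↔ Even p.length := by
    intro g g' p h h' q hpq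
    obtain ⟨p', hp'⟩ := hG.exists_length_add p q.length
    obtain ⟨q', hq'⟩ := hH.exists_length_add q (p'.length / 2 - q.length / 2)
    obtain ⟨r, hr⟩ := exists_tensorProd_walk_of_length_eq p' q' (by grind)
    exact ⟨r, by grind⟩
  rintro ⟨g, h⟩ ⟨g', h'⟩
  obtain ⟨⟨p, hp⟩, ⟨p', hp'⟩⟩ := hG g g'
  obtain ⟨⟨q, hq⟩, ⟨q', hq'⟩⟩ := hH h h'
  obtain ⟨r, hr⟩ := key p q (by simp [hp, hq])
  obtain ⟨r', hr'⟩ := key p' q' (by simp [hp', hq'])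
  exact ⟨⟨r, hr.2 hp⟩, r', fun h => hp' (hr'.1 h)⟩

namespace ProdWeight

variable {F : Type*} [Group F] (w : ProdWeight G H F)

/-- Conjugation by `e` moves the base vertex in `H`; the rectangle over `p` moves it in `G`. -/
theorem swap_alt_eq_one_of_base (hG : G.IsOddConnected) (hH : H.IsOddConnected) {g₀ a₀ : X}
    {h₀ : Y} (ha₀ : G.Adj g₀ a₀)
    (h1 : ∀ q : H.Walk h₀ h₀, Even q.length → w.swap.alt g₀ a₀ q = 1) {g a : X}
    (ha : G.Adj g a) {h : Y} (q : H.Walk h h) (hq : Even q.length) : w.swap.alt g a q = 1 := by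
  obtain ⟨p, hp⟩ := (hG g₀ g).1
  obtain ⟨e, he⟩ := (hH h₀ h).1
  obtain ⟨k, hk⟩ := hH.exists_adj h₀
  have he' : Even e.reverse.length := by rwa [Walk.length_reverse]
  have heq : Even (q.append e.reverse).length := by
    rw [Walk.length_append]; exact hq.add he'
  have heqe : Even (e.append (q.append e.reverse)).length := by
    rw [Walk.length_append]; exact he.add heq
  have h2 := w.alt_mul_alt_swap hp ha₀ ha (e.append (q.append e.reverse)) heqe hk hk
  rw [h1 _ heqe, one_mul, mul_eq_left, alt_append_even _ he, alt_append_even _ hq,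
    alt_reverse_even _ he ha] at h2
  rwa [← mul_assoc, mul_inv_eq_one, mul_eq_left] at h2

/-- Here `σ g h` is the label of any even walk from `h₀` to `h` run at `g`; by `h1` the walk is
immaterial. The translation `τ g g'` compares the base points of adjacent slices. -/
theorem exists_shift (hH : H.IsOddConnected) (h₀ : Y)
    (h1 : ∀ {g a : X}, G.Adj g a → ∀ {h : Y} (q : H.Walk h h), Even q.length →
      w.swap.alt g a q = 1) (hG : ∀ g, ∃ g', G.Adj g g') :
    ∃ (σ : X → Y → F) (τ : X → X → F), ∀ {g g' h h'}, G.Adj g g' → H.Adj h h' →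
      τ g g' * σ g' h' = σ g h * w.wt g h g' h' := by
  choose E hE using fun h => (hH h₀ h).1
  choose b hb using hG
  obtain ⟨k₀, hk₀⟩ := hH.exists_adj h₀
  let σ : X → Y → F := fun g h => w.swap.alt g (b g) (E h)
  have hσ : ∀ {g a h} (q : H.Walk h₀ h), Even q.length → G.Adj g a →
      w.swap.alt g a q = σ g h := by
    intro g a h q hq ha
    have hE' : Even (E h).reverse.length := by rw [Walk.length_reverse]; exact hE h
    have h2 := h1 ha (q.append (E h).reverse) (by rw [Walk.length_append]; exact hq.add hE')
    rw [alt_append_even _ hq, alt_reverse_even _ (hE h) ha, mul_inv_eq_one] at h2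
    rw [h2]
    exact w.swap.alt_congr ha (hb g) _ (hE h)
  refine ⟨σ, fun g g' => w.wt g h₀ g' k₀ * (σ g' k₀)⁻¹, fun {g g' h h'} hg hh => ?_⟩
  have hE' : Even (E k₀).reverse.length := by rw [Walk.length_reverse]; exact hE k₀
  have hev : Even ((E k₀).reverse.append (E h')).length := by
    rw [Walk.length_append]; exact hE'.add (hE h')
  have h2 := hσ (g := g) (a := g') (.cons hk₀ (((E k₀).reverse.append (E h')).concat hh.symm))
    (by simp only [Walk.length_cons, Walk.length_concat]; grind) hg
  rw [alt_cons, Walk.concat_eq_append, alt_append_even _ hev, alt_append_even _ hE',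
    alt_reverse_even _ (hE k₀) hg.symm, hσ _ (hE k₀) hg.symm, hσ _ (hE h') hg.symm, alt_cons,
    alt_nil, mul_one] at h2
  change w.wt g h₀ g' k₀ * ((σ g' k₀)⁻¹ * σ g' h' * w.wt g' h' g h) = σ g h at h2
  rw [← h2]
  simp only [mul_assoc]
  rw [w.mul_symm hg.symm hh.symm, mul_one]

end ProdWeight

variable {V : Type u} {K : SimpleGraph V}

/-- The labelling of the product induced by a homomorphism to a square-free graph. -/
def IsSquareFree.prodWeight (hK : K.IsSquareFree) (μ : G.tensorProd H →g K) :
    ProdWeight G H (FreeGroup (V × V)) where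
  wt g h g' h' := dartLabel (μ (g, h)) (μ (g', h'))
  mul_symm _ _ := dartLabel_mul_symm _ _
  sq_left {g₀ g₁ g₂ h h₁ h₂} a b c d := by
    rcases hK (μ (g₀, h)) (μ (g₁, h₁)) (μ (g₂, h)) (μ (g₁, h₂)) (μ.map_adj ⟨a, c⟩)
      (μ.map_adj ⟨b, c.symm⟩) (μ.map_adj ⟨b.symm, d⟩) (μ.map_adj ⟨a.symm, d.symm⟩) with e | e
    · rw [← e]; simp only [dartLabel_mul_symm]
    · rw [e]
  sq_right {g g₁ g₂ h₀ h₁ h₂} a b c d := by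
    rcases hK (μ (g, h₀)) (μ (g₁, h₁)) (μ (g, h₂)) (μ (g₂, h₁)) (μ.map_adj ⟨a, c⟩)
      (μ.map_adj ⟨a.symm, d⟩) (μ.map_adj ⟨b, d.symm⟩) (μ.map_adj ⟨b.symm, c.symm⟩) with e | e
    · rw [← e]; simp only [dartLabel_mul_symm]
    · rw [e]

theorem IsSquareFree.mapsTo_of_swap_alt_eq_one [Finite Y] (hK : K.IsSquareFree)
    (μ : G.tensorProd H →g K) (hG : G.IsOddConnected) (hH : H.IsOddConnected) {g₀ a₀ : X} {h₀ : Y}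
    (ha₀ : G.Adj g₀ a₀)
    (h1 : ∀ q : H.Walk h₀ h₀, Even q.length → (hK.prodWeight μ).swap.alt g₀ a₀ q = 1) :
    G.MapsTo K := by
  have : Nonempty Y := ⟨h₀⟩
  obtain ⟨σ, τ, h2⟩ := (hK.prodWeight μ).exists_shift hH h₀
    (fun ha _ q hq => (hK.prodWeight μ).swap_alt_eq_one_of_base hG hH ha₀ h1 ha q hq)
    hG.exists_adj
  let S : SliceLift G H K :=
    { pt := fun g h => (μ (g, h), σ g h)
      shift := τ
      adj := fun hg hh => ⟨μ.map_adj ⟨hg, hh⟩, h2 hg hh⟩ }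
  obtain ⟨N, hN⟩ := hH.exists_uniform_length
  exact S.mapsTo hG.exists_adj hH.exists_adj hN

end SimpleGraph

/-! ### Translations of trees and Busemann functions -/

namespace SimpleGraph

section Axis

variable {W : Type u} {T : SimpleGraph W}

theorem Iso.dist_iterate (φ : T ≃g T) (a b : W) (k : ℕ) :
    T.dist (φ^[k] a) (φ^[k] b) = T.dist a b := by
  induction k with
  | zero => rfl
  | succ k ih => rw [Function.iterate_succ_apply', Function.iterate_succ_apply', Iso.dist_eq', ih]

theorem Iso.reachable_iterate (φ : T ≃g T) {x : W} (hx : T.Reachable x (φ x)) (k : ℕ) :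
    T.Reachable x (φ^[k] x) := by
  induction k with
  | zero => exact Reachable.refl _
  | succ k ih =>
    rw [Function.iterate_succ_apply']
    exact hx.trans (φ.reachable_iff.2 ih)

variable {φ : T ≃g T} {x : W}

/-- At a vertex moved a minimal distance, consecutive translates of the geodesic from `x` to `φ x`
meet without backtracking. -/
theorem IsAcyclic.dist_axis_step (hT : T.IsAcyclic) (h2 : φ (φ x) ≠ x)
    (hx : T.Reachable x (φ x)) (hmin : ∀ y, T.Reachable x y → T.dist x (φ x) ≤ T.dist y (φ y))
    {y : W} (hy : T.Adj (φ x) y) (hxy : T.dist x y + 1 = T.dist x (φ x)) :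
    T.dist (φ (φ x)) y = T.dist (φ (φ x)) (φ x) + 1 := by
  have hφx : T.Reachable (φ (φ x)) (φ x) := (φ.reachable_iff.2 hx).symm
  rcases hT.dist_eq_dist_add_one_of_adj_of_reachable _ hy hφx with h | h
  swap
  · exact h
  exfalso
  rw [Iso.dist_eq', dist_comm] at h
  obtain ⟨y', rfl⟩ := φ.surjective y
  rw [Iso.dist_eq'] at h
  have hy' : T.Adj x y' := φ.map_adj_iff.1 hy
  have hr : T.Reachable y' (φ x) := hy'.symm.reachable.trans hx
  by_cases h0 : T.dist (φ x) y' = 0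
  · have e1 : φ x = y' := hr.symm.dist_eq_zero_iff.1 h0
    have e2 : x = φ y' := (hx.trans hy.reachable).dist_eq_zero_iff.1 (by omega)
    exact h2 (e1 ▸ e2.symm)
  · obtain ⟨u, hu, h3⟩ := hr.exists_adj_dist (by rwa [dist_comm])
    rw [dist_comm (v := φ x)] at h3
    have h4 := hy'.reachable.dist_triangle_left u
    rw [dist_eq_one_iff_adj.2 hy'] at h4
    have h5 : T.dist x u + 1 = T.dist x (φ x) := by
      rcases hT.dist_eq_dist_add_one_of_adj_of_reachable x hu hx with h5 | h5 <;> omega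
    obtain rfl := hT.eq_of_dist_add_one hx hu hy h5 hxy
    have := hmin y' hy'.reachable
    omega

/-- By `dist_axis_step` the translates of a geodesic from `x` to `φ x` concatenate to a geodesic. -/
theorem IsAcyclic.dist_iterate (hT : T.IsAcyclic) (h1 : φ x ≠ x) (h2 : φ (φ x) ≠ x)
    (hx : T.Reachable x (φ x)) (hmin : ∀ y, T.Reachable x y → T.dist x (φ x) ≤ T.dist y (φ y))
    (k : ℕ) : T.dist x (φ^[k] x) = k * T.dist x (φ x) := by
  have hn : T.dist x (φ x) ≠ 0 := fun h => h1 (hx.dist_eq_zero_iff.1 h).symm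
  obtain ⟨y, hy, hxy⟩ := hx.exists_adj_dist hn
  have hstep := hT.dist_axis_step h2 hx hmin hy hxy
  have hc := φ.reachable_iterate hx
  have hle : ∀ k, T.dist x (φ^[k] x) ≤ k * T.dist x (φ x) := by
    intro k
    induction k with
    | zero => simp
    | succ k ih =>
      have h := (hc k).dist_triangle_left (φ^[k + 1] x)
      rw [Function.iterate_succ_apply, Iso.dist_iterate, ← Function.iterate_succ_apply] at h
      linarith
  induction k with
  | zero => simp
  | succ k ih =>
    rcases k with _ | k
    · simp
    have hadj : T.Adj (φ^[k + 1] x) (φ^[k] y) := by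
      rw [← dist_eq_one_iff_adj, Function.iterate_succ_apply, Iso.dist_iterate,
        dist_eq_one_iff_adj]
      exact hy
    have h3 : T.dist x (φ^[k] y) + 1 = T.dist x (φ^[k + 1] x) := by
      have h4 := (hc k).dist_triangle_left (φ^[k] y)
      rw [Iso.dist_iterate] at h4
      rcases hT.dist_eq_dist_add_one_of_adj_of_reachable x hadj (hc _) with h6 | h6
      · omega
      · have := hle k
        exfalso
        rw [ih] at h6
        linarith
    have hcc : T.Reachable (φ^[k + 1 + 1] x) (φ^[k + 1] x) := (hc _).symm.trans (hc _)
    have e1 : T.dist (φ^[k + 1 + 1] x) (φ^[k + 1] x) = T.dist x (φ x) := by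
      rw [Function.iterate_succ_apply, Iso.dist_iterate, dist_comm]
    have e2 : T.dist (φ^[k + 1 + 1] x) (φ^[k] y) = T.dist x (φ x) + 1 := by
      rw [Function.iterate_succ_apply, Function.iterate_succ_apply, Iso.dist_iterate, hstep,
        Iso.dist_eq', dist_comm]
    have h4 := hT.dist_eq_add hadj (hc _) hcc h3 (by rw [e1, e2])
    rw [dist_comm, h4, e1, ih]
    ring

theorem eventually_eq_of_antitone {a : ℕ → ℤ} (ha : Antitone a) {C : ℤ} (hC : ∀ k, C ≤ a k) :
    ∃ b, ∀ᶠ k in Filter.atTop, a k = b := by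
  classical
  have hex : ∃ m k, (a k - C).toNat = m := ⟨_, 0, rfl⟩
  obtain ⟨k, hk⟩ := Nat.find_spec hex
  refine ⟨a k, Filter.eventually_atTop.2 ⟨k, fun l hl => ?_⟩⟩
  have h1 := Nat.find_min' hex ⟨l, rfl⟩
  have h2 := ha hl
  have h3 := hC l
  have h4 := hC k
  omega

/-- The Busemann function of an automorphism of a tree without fixed vertices or inverted edges:
it changes by one along every edge and is shifted by the translation length. -/
theorem IsAcyclic.exists_busemann (hT : T.IsAcyclic) (h1 : ∀ y, φ y ≠ y) (h2 : ∀ y, φ (φ y) ≠ y)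
    {x₀ : W} (hx₀ : T.Reachable x₀ (φ x₀)) :
    ∃ (x : W) (b : W → ℤ), T.Reachable x₀ x ∧
      (∀ p, T.Reachable x₀ p → b (φ p) = b p - T.dist x (φ x)) ∧
      ∀ p q, T.Reachable x₀ p → T.Adj p q → b q = b p + 1 ∨ b p = b q + 1 := by
  classical
  have hex : ∃ n x, T.Reachable x₀ x ∧ T.dist x (φ x) = n := ⟨_, x₀, Reachable.refl _, rfl⟩
  obtain ⟨x, hx, hxn⟩ := Nat.find_spec hex
  have hmin : ∀ y, T.Reachable x y → T.dist x (φ x) ≤ T.dist y (φ y) := fun y hy =>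
    hxn ▸ Nat.find_min' hex ⟨y, hx.trans hy, rfl⟩
  have hxφ : T.Reachable x (φ x) := hx.symm.trans (hx₀.trans (φ.reachable_iff.2 hx))
  set n := T.dist x (φ x) with hn
  have hit := hT.dist_iterate (h1 x) (h2 x) hxφ hmin
  have hc := φ.reachable_iterate hxφ
  -- The Busemann function is the limit of `dist p (φ^[k] x) - k * n`. This integer sequence does
  -- not increase, since consecutive iterates are `n` apart, and is bounded below, since `φ^[k] x`
  -- is `k * n` away from `x`.
  have hlim : ∀ p, T.Reachable x₀ p →
      ∃ b : ℤ, ∀ᶠ k in Filter.atTop, (T.dist p (φ^[k] x) : ℤ) - k * n = b := by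
    intro p hp
    refine eventually_eq_of_antitone (antitone_nat_of_succ_le fun k => ?_)
      (C := -(T.dist x p : ℤ)) fun k => ?_
    · have h3 := ((hp.symm.trans hx).trans (hc k)).dist_triangle_left (φ^[k + 1] x)
      rw [Function.iterate_succ_apply (n := k), Iso.dist_iterate, ← hn] at h3
      rw [Function.iterate_succ_apply]
      push_cast
      zify at h3
      linarith
    · have h3 := (hx.symm.trans hp).dist_triangle_left (φ^[k] x)
      rw [hit k, ← hn] at h3
      zify at h3
      linarith
  choose! b hb using hlim
  refine ⟨x, b, hx, fun p hp => ?_, fun p q hp hpq => ?_⟩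
  · have hφp : T.Reachable x₀ (φ p) := hx₀.trans (φ.reachable_iff.2 hp)
    obtain ⟨k, h3, h4⟩ := (((Filter.tendsto_add_atTop_nat 1).eventually (hb _ hφp)).and
      (hb p hp)).exists
    rw [Function.iterate_succ_apply', Iso.dist_eq'] at h3
    push_cast at h3
    linarith
  · obtain ⟨k, h3, h4⟩ := ((hb p hp).and (hb q (hp.trans hpq.reachable))).exists
    have h5 := hT.dist_eq_dist_add_one_of_adj_of_reachable (φ^[k] x) hpq
      (((hp.symm.trans hx).trans (hc k)).symm)
    rw [dist_comm (v := p), dist_comm (v := q)] at h5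
    omega

end Axis

/-! ### The group of labels of closed walks -/

namespace ProdWeight

variable {X : Type v} {Y : Type w} {G : SimpleGraph X} {H : SimpleGraph Y}

theorem val_reverse {F : Type*} [Group F] (w : ProdWeight G H F) {p q : X × Y}
    (P : (G.tensorProd H).Walk p q) : w.val P.reverse = (w.val P)⁻¹ := by
  induction P with
  | nil => simp [val]
  | cons h P ih =>
    rw [Walk.reverse_cons, val_append, ih]
    simp only [val, mul_one, mul_inv_rev]
    rw [inv_eq_of_mul_eq_one_right (w.mul_symm h.1 h.2)]

/-- The labels of the closed walks at `p`. -/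
def loopSubgroup {F : Type*} [Group F] (w : ProdWeight G H F) (p : X × Y) : Subgroup F where
  carrier := {a | ∃ P : (G.tensorProd H).Walk p p, w.val P = a}
  one_mem' := ⟨.nil, rfl⟩
  mul_mem' := by
    rintro _ _ ⟨P, rfl⟩ ⟨Q, rfl⟩
    exact ⟨P.append Q, w.val_append P Q⟩
  inv_mem' := by
    rintro _ ⟨P, rfl⟩
    exact ⟨P.reverse, w.val_reverse P⟩

/-- By `val_eq` and transitivity of commutation, all even closed walks commute with `z`. An odd one
commutes with its own square, which is even and, unless the label is `1`, nontrivial. So the labels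
lie in the cyclic centralizer of `z`. -/
theorem isCyclic_loopSubgroup {α : Type u} (w : ProdWeight G H (FreeGroup α)) {g₀ a₀ : X}
    {h₀ k₀ : Y} (ha : G.Adj g₀ a₀) (hk : H.Adj h₀ k₀) {p : G.Walk g₀ g₀} (hp : Even p.length)
    (hp1 : w.alt h₀ k₀ p ≠ 1) {q : H.Walk h₀ h₀} (hq : Even q.length)
    (hq1 : w.swap.alt g₀ a₀ q ≠ 1) : IsCyclic (w.loopSubgroup (g₀, h₀)) := by
  set z := w.alt h₀ k₀ p
  have hswap : ∀ (p' : G.Walk g₀ g₀) (q' : H.Walk h₀ h₀), Even p'.length → Even q'.length →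
      Commute (w.alt h₀ k₀ p') (w.swap.alt g₀ a₀ q') :=
    fun p' q' hp' hq' => w.alt_mul_alt_swap hp' ha ha q' hq' hk hk
  have heven : ∀ P : (G.tensorProd H).Walk (g₀, h₀) (g₀, h₀), Even P.length →
      Commute z (w.val P) := by
    intro P hP
    rw [w.val_eq P hP (h₁ := k₀) (a := a₀) hk ha]
    refine Commute.mul_right ?_ (hswap p _ hp (by rwa [length_sndWalk]))
    exact FreeGroup.commute_trans hq1 (hswap p q hp hq).symm
      (hswap _ q (by rwa [length_fstWalk]) hq).symm
  have hall : ∀ P : (G.tensorProd H).Walk (g₀, h₀) (g₀, h₀), Commute z (w.val P) := by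
    intro P
    have h1 := heven (P.append P) (by rw [Walk.length_append]; exact ⟨_, rfl⟩)
    rw [w.val_append, ← pow_two] at h1
    by_cases h2 : w.val P ^ 2 = 1
    · rw [pow_eq_one_iff_left two_ne_zero] at h2
      rw [h2]
      exact Commute.one_right z
    · exact FreeGroup.commute_trans h2 h1.symm (Commute.pow_self _ 2)
  have := FreeGroup.isCyclic_centralizer hp1
  refine Subgroup.isCyclic_of_le (H' := Subgroup.centralizer {z}) ?_
  rintro _ ⟨P, rfl⟩
  exact Subgroup.mem_centralizer_singleton_iff.2 (hall P).eq.symm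

end ProdWeight

end SimpleGraph

/-! ### Multiplicativity of odd cycles -/

namespace SimpleGraph

variable {X : Type v} {Y : Type w} {G : SimpleGraph X} {H : SimpleGraph Y}

theorem exists_eq_two_mul_of_even {n : ℕ} (hn : Odd n) {x : ℤ} (hx : Even x)
    (hx0 : (x : ZMod n) = 0) :
    ∃ i : ℤ, x = 2 * (n * i) := by
  obtain ⟨j, hj⟩ := (ZMod.intCast_zmod_eq_zero_iff_dvd x n).1 hx0
  have hn' : Odd (n : ℤ) := (Int.odd_coe_nat n).2 hn
  have : Even j := by
    rw [hj, Int.even_mul] at hx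
    rcases hx with h | h
    · exact absurd h (Int.not_even_iff_odd.2 hn')
    · exact h
  obtain ⟨k, rfl⟩ := this
  exact ⟨k, by rw [hj]; ring⟩

namespace ProdWeight

/-- `w` labels every dart by `1` or `-1`, and this is the increment of `m` along the dart. -/
def IsIncrement (w : ProdWeight G H (Multiplicative ℤ)) {n : ℕ} (m : X → Y → ZMod n) : Prop :=
  ∀ g h g' h', G.Adj g g' → H.Adj h h' →
    ((Multiplicative.toAdd (w.wt g h g' h') : ℤ) : ZMod n) = m g' h' - m g h ∧
      (Multiplicative.toAdd (w.wt g h g' h') = 1 ∨ Multiplicative.toAdd (w.wt g h g' h') = -1)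

namespace IsIncrement

variable {w : ProdWeight G H (Multiplicative ℤ)} {n : ℕ} {m : X → Y → ZMod n}
  (hw : w.IsIncrement m)

include hw

theorem swap : w.swap.IsIncrement fun h g => m g h := fun h g h' g' a b => hw g h g' h' b a

theorem adj {g g' : X} {h h' : Y} (hg : G.Adj g g') (hh : H.Adj h h') :
    m g' h' = m g h + 1 ∨ m g h = m g' h' + 1 := by
  obtain ⟨h1, h2 | h2⟩ := hw g h g' h' hg hh
  · left
    rw [h2] at h1
    linear_combination -h1
  · right
    rw [h2] at h1
    push_cast at h1
    linear_combination h1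

theorem even_val {p q : X × Y} (P : (G.tensorProd H).Walk p q) :
    Even (Multiplicative.toAdd (w.val P) + P.length) := by
  induction P with
  | nil => simp [val]
  | @cons p r q h P ih =>
    rw [val, toAdd_mul, Walk.length_cons]
    rcases (hw _ _ _ _ h.1 h.2).2 with h1 | h1 <;> rw [h1] <;> push_cast <;> grind

theorem even_alt {g g' : X} (p : G.Walk g g') {h h₁ : Y} (hh : H.Adj h h₁) :
    Even (Multiplicative.toAdd (w.alt h h₁ p) + p.length) := by
  induction p generalizing h h₁ with
  | nil => simp
  | @cons g k g' hg p ih =>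
    have := ih hh.symm
    rw [alt_cons, toAdd_mul, Walk.length_cons]
    rcases (hw _ _ _ _ hg hh).2 with h1 | h1 <;> rw [h1] <;> push_cast <;> grind

theorem cast_alt {g g' : X} (p : G.Walk g g') {h h₁ : Y} (hh : H.Adj h h₁) :
    ((Multiplicative.toAdd (w.alt h h₁ p) : ℤ) : ZMod n) =
      (if Even p.length then m g' h else m g' h₁) - m g h := by
  induction p generalizing h h₁ with
  | nil => simp
  | @cons g k g' hg p ih =>
    rw [alt_cons, toAdd_mul, Int.cast_add, ih hh.symm, (hw _ _ _ _ hg hh).1]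
    by_cases he : Even p.length <;> simp [he, Nat.even_add_one]

/-- If some odd closed walk in `G` has odd winding number, then the first factor maps to the
cycle. -/
theorem exists_map (hn : Odd n) (hG : G.IsOddConnected) (hH : H.IsOddConnected) {h₀ h₁ : Y}
    (hh : H.Adj h₀ h₁) {g₀ : X} {c : G.Walk g₀ g₀} (hc : ¬ Even c.length) {i : ℤ} (hi : Odd i)
    (hci : Multiplicative.toAdd (w.alt h₀ h₁ c) + Multiplicative.toAdd (w.alt h₁ h₀ c) =
      2 * (n * i)) :
    ∃ f : X → ZMod n, ∀ g g', G.Adj g g' → f g' = f g + 1 ∨ f g = f g' + 1 := by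
  classical
  let s : {g g' : X} → G.Walk g g' → ℤ := fun p => Multiplicative.toAdd (w.alt h₀ h₁ p)
  let t : {g g' : X} → G.Walk g g' → ℤ := fun p => Multiplicative.toAdd (w.alt h₁ h₀ p)
  have hclosed : ∀ a : G.Walk g₀ g₀, Even a.length → s a = t a := by
    intro a ha
    obtain ⟨q, hq⟩ := (hH h₀ h₁).1
    obtain ⟨b, hb⟩ := hG.exists_adj g₀
    have h1 := w.alt_mul_alt_swap ha hb hb q hq hh hh.symm
    rw [mul_comm, mul_right_inj] at h1
    exact congrArg Multiplicative.toAdd h1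
  have hodd : ∀ c' : G.Walk g₀ g₀, ¬ Even c'.length → s c' - t c' = s c - t c := by
    intro c' hc'
    have h1 := hclosed (c.append c') (by rw [Walk.length_append]; grind)
    simp only [s, t, alt_append_odd _ hc, toAdd_mul] at h1 ⊢
    linarith
  choose E hE using fun g => (hG g₀ g).1
  -- By `hci`, `s c - n * i` is half of `s c - t c`, a difference shared by all odd closed walks at
  -- `g₀`. So `δ g` is an integer lift of `m g h₁ - m g h₀`, even because `n * i` is odd.
  let δ : X → ℤ := fun g => s c - n * i + t (E g) - s (E g)
  have hδeven : ∀ g, Even (δ g) := by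
    intro g
    have h1 := hw.even_alt (E g) hh
    have h2 := hw.even_alt (E g) hh.symm
    have h3 := hw.even_alt c hh
    have h4 : Odd ((n : ℤ) * i) := ((Int.odd_coe_nat n).2 hn).mul hi
    have h5 : Even ((E g).length : ℤ) := (Int.even_coe_nat _).2 (hE g)
    have h6 : ¬ Even (c.length : ℤ) := mt (Int.even_coe_nat _).1 hc
    simp only [δ, s, t]
    grind
  have hδcast : ∀ g, (δ g : ZMod n) = m g h₁ - m g h₀ := by
    intro g
    have h1 := hw.cast_alt (E g) hh
    have h2 := hw.cast_alt (E g) hh.symm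
    have h3 := hw.cast_alt c hh
    rw [if_pos (hE g)] at h1 h2
    rw [if_neg hc] at h3
    simp only [δ, s, t]
    push_cast
    rw [h1, h2, h3, ZMod.natCast_self]
    ring
  have hδadd : ∀ g g', G.Adj g g' → δ g + δ g' = Multiplicative.toAdd (w.wt g h₀ g' h₁) -
      Multiplicative.toAdd (w.wt g h₁ g' h₀) := by
    intro g g' hg
    have h1 := hodd ((E g).append (.cons hg (E g').reverse)) (by
      have := hE g
      have := hE g'
      simp only [Walk.length_append, Walk.length_cons, Walk.length_reverse]
      grind)
    simp only [s, t, alt_append_even _ (hE g), alt_cons, toAdd_mul, toAdd_inv,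
      alt_reverse_even _ (hE g') hh, alt_reverse_even _ (hE g') hh.symm] at h1
    simp only [δ, s, t]
    linarith
  -- For adjacent `g`, `g'` the sum `δ g + δ g'` lies in `{-2, 0, 2}`. Two nonnegative even values
  -- then include a zero, where `m g h₁ = m g h₀`; two negative ones are impossible; opposite signs
  -- select adjacent vertices of the product.
  refine ⟨fun g => if 0 ≤ δ g then m g h₁ else m g h₀, fun g g' hg => ?_⟩
  have h1 := hδadd g g' hg
  have h2 := (hw _ _ _ _ hg hh).2
  have h3 := (hw _ _ _ _ hg hh.symm).2
  obtain ⟨x, hx⟩ := hδeven g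
  obtain ⟨y, hy⟩ := hδeven g'
  have hzero : ∀ g, δ g = 0 → m g h₁ = m g h₀ := by
    intro g h
    have := hδcast g
    rw [h, Int.cast_zero] at this
    linear_combination -this
  by_cases h4 : 0 ≤ δ g <;> by_cases h5 : 0 ≤ δ g' <;> simp only [h4, h5, if_true, if_false]
  · rcases (by omega : δ g = 0 ∨ δ g' = 0) with h6 | h6
    · rw [hzero g h6]
      exact hw.adj hg hh
    · rw [hzero g' h6]
      exact hw.adj hg hh.symm
  · exact hw.adj hg hh.symm
  · exact hw.adj hg hh
  · omega

/-- Odd cycles are multiplicative. -/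
theorem exists_map_or (hn : Odd n) (hG : G.IsOddConnected) (hH : H.IsOddConnected) (g₀ : X)
    (h₀ : Y) :
    (∃ f : X → ZMod n, ∀ g g', G.Adj g g' → f g' = f g + 1 ∨ f g = f g' + 1) ∨
      ∃ f : Y → ZMod n, ∀ h h', H.Adj h h' → f h' = f h + 1 ∨ f h = f h' + 1 := by
  obtain ⟨P, hP⟩ := (hG.tensorProd hH (g₀, h₀) (g₀, h₀)).2
  obtain ⟨a₀, ha⟩ := hG.exists_adj g₀
  obtain ⟨k₀, hk⟩ := hH.exists_adj h₀
  have hc : ¬ Even (fstWalk P).length := by rwa [length_fstWalk]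
  have hd : ¬ Even (sndWalk P).length := by rwa [length_sndWalk]
  have hPP : Even (P.append P).length := by rw [Walk.length_append]; exact ⟨_, rfl⟩
  have h1 := w.val_eq (P.append P) hPP (h₁ := k₀) (a := a₀) hk ha
  have e1 : fstWalk (P.append P) = (fstWalk P).append (fstWalk P) := Walk.map_append _ _ _
  have e2 : sndWalk (P.append P) = (sndWalk P).append (sndWalk P) := Walk.map_append _ _ _
  rw [e1, e2, val_append, alt_append_odd _ hc, alt_append_odd _ hd] at h1
  have h2 := congrArg Multiplicative.toAdd h1
  simp only [toAdd_mul] at h2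
  obtain ⟨i, hi⟩ := exists_eq_two_mul_of_even hn
    (x := Multiplicative.toAdd (w.alt h₀ k₀ (fstWalk P)) +
      Multiplicative.toAdd (w.alt k₀ h₀ (fstWalk P)))
    (by
      have h3 := hw.even_alt (fstWalk P) hk
      have h4 := hw.even_alt (fstWalk P) hk.symm
      grind)
    (by
      rw [Int.cast_add, hw.cast_alt _ hk, hw.cast_alt _ hk.symm, if_neg hc, if_neg hc]
      ring)
  obtain ⟨j, hj⟩ := exists_eq_two_mul_of_even hn
    (x := Multiplicative.toAdd (w.swap.alt g₀ a₀ (sndWalk P)) +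
      Multiplicative.toAdd (w.swap.alt a₀ g₀ (sndWalk P)))
    (by
      have h3 := hw.swap.even_alt (sndWalk P) ha
      have h4 := hw.swap.even_alt (sndWalk P) ha.symm
      grind)
    (by
      rw [Int.cast_add, hw.swap.cast_alt _ ha, hw.swap.cast_alt _ ha.symm, if_neg hd, if_neg hd]
      ring)
  -- Splitting the doubled walk gives the label `n * (i + j)` to `P`, and this has the parity of the
  -- odd length of `P`.
  have hij : Odd (i + j) := by
    have h3 : Multiplicative.toAdd (w.val P) = n * (i + j) := by linarith
    have h4 := hw.even_val P
    rw [h3] at h4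
    rw [← Int.not_even_iff_odd]
    intro h5
    have h6 := (Int.even_add.1 h4).1 (h5.mul_left _)
    exact hP ((Int.even_coe_nat _).1 h6)
  by_cases hio : Odd i
  · exact Or.inl (hw.exists_map hn hG hH hk hc hio hi)
  · refine Or.inr (hw.swap.exists_map hn hH hG ha hd (i := j) ?_ hj)
    grind

end IsIncrement

end ProdWeight

end SimpleGraph

/-! ### The case of cyclic labels: passing to an odd cycle -/

namespace SimpleGraph

variable {X : Type v} {Y : Type w} {G : SimpleGraph X} {H : SimpleGraph Y}

/-- The increments of a map to an odd cycle. -/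
theorem exists_isIncrement {n : ℕ} (hn : Odd n) (hn1 : n ≠ 1) (m : X → Y → ZMod n)
    (hm : ∀ g h g' h', G.Adj g g' → H.Adj h h' → m g' h' = m g h + 1 ∨ m g h = m g' h' + 1) :
    ∃ w : ProdWeight G H (Multiplicative ℤ), w.IsIncrement m := by
  classical
  let e : X → Y → X → Y → ℤ := fun g h g' h' => if m g' h' = m g h + 1 then 1 else -1
  have he : ∀ g h g' h', e g h g' h' = 1 ∨ e g h g' h' = -1 := by
    intro g h g' h'
    simp only [e]
    split_ifs <;> simp
  have hcast : ∀ g h g' h', G.Adj g g' → H.Adj h h' →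
      (e g h g' h' : ZMod n) = m g' h' - m g h := by
    intro g h g' h' hg hh
    simp only [e]
    split_ifs with h1
    · rw [h1]; push_cast; ring
    · rw [(hm g h g' h' hg hh).resolve_left h1]; push_cast; ring
  -- An even multiple of an odd `n ≥ 3` is a multiple of `2n ≥ 6`. This covers `n = 3` as well.
  have hsmall : ∀ x : ℤ, Even x → |x| ≤ 4 → (x : ZMod n) = 0 → x = 0 := by
    intro x hx hx4 hx0
    obtain ⟨i, rfl⟩ := exists_eq_two_mul_of_even hn hx hx0
    have h3 : (3 : ℤ) ≤ n := by
      obtain ⟨k, rfl⟩ := hn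
      push_cast
      omega
    rw [abs_le] at hx4
    have h1 : i < 1 := by nlinarith
    have h2 : -1 < i := by nlinarith
    have : i = 0 := by omega
    simp [this]
  have hsub : ∀ {a b c d : ℤ}, (a = 1 ∨ a = -1) → (b = 1 ∨ b = -1) → (c = 1 ∨ c = -1) →
      (d = 1 ∨ d = -1) → ((a + b - (c + d) : ℤ) : ZMod n) = 0 → a + b = c + d := by
    intro a b c d ha hb hc hd h
    refine sub_eq_zero.1 (hsmall _ ?_ ?_ h) <;>
      rcases ha with rfl | rfl <;> rcases hb with rfl | rfl <;> rcases hc with rfl | rfl <;>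
      rcases hd with rfl | rfl <;> decide
  refine ⟨⟨fun g h g' h' => Multiplicative.ofAdd (e g h g' h'), ?_, ?_, ?_⟩, ?_⟩
  · intro g g' h h' hg hh
    rw [← ofAdd_add, ← ofAdd_zero]
    congr 1
    refine hsmall _ ?_ ?_ ?_
    iterate 2
      rcases he g h g' h' with h1 | h1 <;> rcases he g' h' g h with h2 | h2 <;> rw [h1, h2] <;>
        decide
    rw [Int.cast_add, hcast _ _ _ _ hg hh, hcast _ _ _ _ hg.symm hh.symm]
    ring
  · intro g₀ g₁ g₂ h h₁ h₂ a b c d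
    rw [← ofAdd_add, ← ofAdd_add]
    congr 1
    refine hsub (he _ _ _ _) (he _ _ _ _) (he _ _ _ _) (he _ _ _ _) ?_
    push_cast
    rw [hcast _ _ _ _ a c, hcast _ _ _ _ b c.symm, hcast _ _ _ _ a d, hcast _ _ _ _ b d.symm]
    ring
  · intro g g₁ g₂ h₀ h₁ h₂ a b c d
    rw [← ofAdd_add, ← ofAdd_add]
    congr 1
    refine hsub (he _ _ _ _) (he _ _ _ _) (he _ _ _ _) (he _ _ _ _) ?_
    push_cast
    rw [hcast _ _ _ _ a c, hcast _ _ _ _ a.symm d, hcast _ _ _ _ b c, hcast _ _ _ _ b.symm d]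
    ring
  · exact fun g h g' h' hg hh => ⟨hcast g h g' h' hg hh, he g h g' h'⟩

variable {V : Type u} {K : SimpleGraph V}

theorem mapsTo_of_cycle {x : V} (c : K.Walk x x) (hc : c.length ≠ 0)
    (hf : ∃ f : X → ZMod c.length, ∀ g g', G.Adj g g' → f g' = f g + 1 ∨ f g = f g' + 1) :
    G.MapsTo K := by
  have : NeZero c.length := ⟨hc⟩
  obtain ⟨f, hf⟩ := hf
  have key : ∀ i : ZMod c.length, K.Adj (c.getVert i.val) (c.getVert (i + 1).val) := by
    intro i
    have h1 := c.adj_getVert_succ i.val_lt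
    rcases (Nat.succ_le_of_lt i.val_lt).lt_or_eq with h2 | h2
    · have h3 : (i + 1).val = i.val + 1 := by
        rw [← ZMod.val_natCast_of_lt (show i.val + 1 < _ from h2), Nat.cast_succ,
          ZMod.natCast_zmod_val]
      rwa [h3]
    · have h3 : (i + 1).val = 0 := by
        rw [ZMod.val_eq_zero, ← ZMod.natCast_zmod_val i, ← Nat.cast_succ, h2, ZMod.natCast_self]
      rw [h3, c.getVert_zero]
      rwa [show i.val + 1 = c.length from h2, c.getVert_length] at h1
  refine ⟨⟨fun g => c.getVert (f g).val, fun {g g'} hg => ?_⟩⟩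
  rcases hf g g' hg with h | h
  · rw [h]; exact key _
  · rw [h]; exact (key _).symm

namespace IsSquareFree

theorem exists_cover_walk (hK : K.IsSquareFree) (μ : G.tensorProd H →g K) {p q : X × Y}
    (P : (G.tensorProd H).Walk p q) (a : FreeGroup (V × V)) :
    ∃ Q : K.coverForest.Walk (μ p, a) (μ q, a * (hK.prodWeight μ).val P),
      Q.length = P.length := by
  induction P generalizing a with
  | nil => exact ⟨Walk.nil.copy rfl (by simp [ProdWeight.val]), by simp⟩
  | @cons p r q h P ih =>
    obtain ⟨Q, hQ⟩ := ih (a * dartLabel (μ p) (μ r))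
    have hadj : K.coverForest.Adj (μ p, a) (μ r, a * dartLabel (μ p) (μ r)) := ⟨μ.map_adj h, rfl⟩
    refine ⟨(Walk.cons hadj Q).copy rfl (by rw [mul_assoc]; rfl), ?_⟩
    rw [Walk.length_copy, Walk.length_cons, Walk.length_cons, hQ]

/-- Lifts of a vertex of the product differ by powers of the generator `R`, which shift the Busemann
function by multiples of the translation length. A geodesic from `x` to its translate projects to a
closed walk in `K` of that length. -/
theorem exists_cycle_map (hK : K.IsSquareFree) (μ : G.tensorProd H →g K)
    (hGH : (G.tensorProd H).IsOddConnected) (p₀ : X × Y)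
    (hcyc : IsCyclic ((hK.prodWeight μ).loopSubgroup p₀)) :
    ∃ (x : V) (c : K.Walk x x), Odd c.length ∧ ∃ m : X → Y → ZMod c.length,
      ∀ g h g' h', G.Adj g g' → H.Adj h h' → m g' h' = m g h + 1 ∨ m g h = m g' h' + 1 := by
  classical
  set w := hK.prodWeight μ with hw
  have hT := K.isAcyclic_coverForest
  obtain ⟨⟨R, P₁, hP₁⟩, hR⟩ := hcyc
  have hRP : ∀ P : (G.tensorProd H).Walk p₀ p₀, ∃ k : ℤ, R ^ k = w.val P := by
    intro P
    obtain ⟨k, hk⟩ := hR ⟨_, P, rfl⟩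
    exact ⟨k, congrArg Subtype.val hk⟩
  obtain ⟨P₀, hP₀⟩ := (hGH p₀ p₀).2
  obtain ⟨k₀, hk₀⟩ := hRP P₀
  obtain ⟨Q₀, hQ₀⟩ : ∃ Q : K.coverForest.Walk (μ p₀, 1) (μ p₀, R ^ k₀),
      Q.length = P₀.length := by
    have h1 := hK.exists_cover_walk μ P₀ 1
    rwa [one_mul, ← hw, ← hk₀] at h1
  -- Otherwise the odd closed walk `P₀` would lift to an odd closed walk in a forest.
  have hR1 : R ≠ 1 := by
    intro h
    have h1 := hT.even_dist_add_length (Reachable.refl _) Q₀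
    rw [hQ₀, h, one_zpow, dist_self, zero_add, zero_add] at h1
    exact hP₀ h1
  set φ := K.coverTranslate R
  have hφ : ∀ (a : FreeGroup (V × V)) (x : V), φ (x, a) = (x, R * a) := fun _ _ => rfl
  have hφ1 : ∀ y, φ y ≠ y := by
    rintro ⟨x, a⟩ h
    exact hR1 (mul_eq_right.1 (congrArg Prod.snd h : R * a = a))
  have hφ2 : ∀ y, φ (φ y) ≠ y := by
    rintro ⟨x, a⟩ h
    have h1 : R * (R * a) = a := congrArg Prod.snd h
    rw [← mul_assoc, mul_eq_right, ← pow_two, pow_eq_one_iff_left two_ne_zero] at h1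
    exact hR1 h1
  let x₀ : V × FreeGroup (V × V) := (μ p₀, 1)
  have hreach : ∀ {p} (P : (G.tensorProd H).Walk p₀ p),
      K.coverForest.Reachable x₀ (μ p, w.val P) := by
    intro p P
    obtain ⟨Q, -⟩ := hK.exists_cover_walk μ P 1
    rw [one_mul] at Q
    exact Q.reachable
  have hx₀φ : K.coverForest.Reachable x₀ (φ x₀) := by
    have h1 := hreach P₁
    rw [hP₁] at h1
    change K.coverForest.Reachable x₀ (μ p₀, R * 1)
    rwa [mul_one]
  obtain ⟨x, b, hx, hb, hb'⟩ := hT.exists_busemann hφ1 hφ2 hx₀φ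
  have hxφ : K.coverForest.Reachable x (φ x) := hx.symm.trans (hx₀φ.trans (φ.reachable_iff.2 hx))
  obtain ⟨Q, hQ⟩ := hxφ.exists_walk_length_eq_dist
  let π : K.coverForest →g K := ⟨Prod.fst, And.left⟩
  let c : K.Walk x.1 x.1 := Q.map π
  have hc : c.length = K.coverForest.dist x (φ x) := (Walk.length_map _ _).trans hQ
  rw [← hc] at hb
  have hbpow : ∀ (y : V) (k : ℤ) (a : FreeGroup (V × V)), K.coverForest.Reachable x₀ (y, a) →
      K.coverForest.Reachable x₀ (y, R ^ k * a) ∧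
        b (y, R ^ k * a) = b (y, a) - k * c.length := by
    intro y k
    induction k with
    | zero => intro a ha; simpa using ha
    | succ k ih =>
      intro a ha
      obtain ⟨h1, h2⟩ := ih a ha
      have h3 := hb _ h1
      have h4 : φ (y, R ^ (k : ℤ) * a) = (y, R ^ ((k : ℤ) + 1) * a) := by
        rw [hφ, add_comm, zpow_add, zpow_one, mul_assoc]
      rw [h4, h2] at h3
      refine ⟨?_, by rw [h3]; ring⟩
      rw [← h4]
      exact hx₀φ.trans (φ.reachable_iff.2 h1)
    | pred k ih =>
      intro a ha
      obtain ⟨h1, h2⟩ := ih a ha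
      have h4 : φ (y, R ^ (-(k : ℤ) - 1) * a) = (y, R ^ (-(k : ℤ)) * a) := by
        rw [hφ, ← mul_assoc, ← zpow_one_add]
        congr 3
        ring
      have h5 : K.coverForest.Reachable x₀ (y, R ^ (-(k : ℤ) - 1) * a) := by
        rw [← φ.reachable_iff, h4]
        exact hx₀φ.symm.trans h1
      have h3 := hb _ h5
      rw [h4, h2] at h3
      exact ⟨h5, by linarith⟩
  have hbpar : ∀ {p q} (Q : K.coverForest.Walk p q), K.coverForest.Reachable x₀ p →
      Even (b p + b q + Q.length) := by
    intro p q Q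
    induction Q with
    | nil => intro _; simp
    | cons h Q ih =>
      intro hp
      have h1 := ih (hp.trans h.reachable)
      have h2 := hb' _ _ hp h
      rw [Walk.length_cons]
      push_cast
      grind
  refine ⟨x.1, c, ?_, ?_⟩
  -- Along the lift of `P₀` the Busemann function changes by `k₀ * c.length`, which must be odd like
  -- the length of `P₀`.
  · have h1 := hbpar Q₀ (Reachable.refl _)
    have h2 := (hbpow (μ p₀) k₀ 1 (Reachable.refl _)).2
    rw [mul_one] at h2
    rw [hQ₀, h2] at h1
    rw [← Nat.not_even_iff_odd]
    intro h3
    have h4 : Even (k₀ * (c.length : ℤ)) := ((Int.even_coe_nat _).2 h3).mul_left _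
    have h5 : ¬ Even (P₀.length : ℤ) := mt (Int.even_coe_nat _).1 hP₀
    grind
  · choose P hP using fun p => (hGH p₀ p).1
    refine ⟨fun g h => (b (μ (g, h), w.val (P (g, h))) : ZMod c.length), ?_⟩
    intro g h g' h' hg hh
    have hadj : (G.tensorProd H).Adj (g, h) (g', h') := ⟨hg, hh⟩
    obtain ⟨k, hk⟩ := hRP (((P (g, h)).append (.cons hadj .nil)).append (P (g', h')).reverse)
    rw [w.val_append, w.val_append, w.val_reverse, eq_mul_inv_iff_mul_eq] at hk
    have h1 : K.coverForest.Adj (μ (g, h), w.val (P (g, h)))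
        (μ (g', h'), R ^ k * w.val (P (g', h'))) := by
      rw [hk]
      refine ⟨μ.map_adj hadj, ?_⟩
      simp only [ProdWeight.val, mul_one]
      rfl
    have h2 := hb' _ _ (hreach _) h1
    rw [(hbpow _ k _ (hreach _)).2] at h2
    rcases h2 with h2 | h2
    · left
      have := congrArg (Int.cast : ℤ → ZMod c.length) h2
      push_cast at this
      simpa using this
    · right
      have := congrArg (Int.cast : ℤ → ZMod c.length) h2
      push_cast at this
      simpa using this

theorem mapsTo_or_of_isOddConnected [Finite X] [Finite Y] (hK : K.IsSquareFree)
    (μ : G.tensorProd H →g K) (hG : G.IsOddConnected) (hH : H.IsOddConnected) (g₀ : X) (h₀ : Y) :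
    G.MapsTo K ∨ H.MapsTo K := by
  obtain ⟨a₀, ha⟩ := hG.exists_adj g₀
  obtain ⟨k₀, hk⟩ := hH.exists_adj h₀
  by_cases h1 : ∀ q : H.Walk h₀ h₀, Even q.length → (hK.prodWeight μ).swap.alt g₀ a₀ q = 1
  · exact Or.inl (hK.mapsTo_of_swap_alt_eq_one μ hG hH ha h1)
  by_cases h2 : ∀ p : G.Walk g₀ g₀, Even p.length → (hK.prodWeight μ).alt h₀ k₀ p = 1
  · let μ' : H.tensorProd G →g K := ⟨fun p => μ (p.2, p.1), fun h => μ.map_adj ⟨h.2, h.1⟩⟩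
    exact Or.inr (hK.mapsTo_of_swap_alt_eq_one μ' hH hG hk h2)
  push Not at h1 h2
  obtain ⟨q, hq, hq1⟩ := h1
  obtain ⟨p, hp, hp1⟩ := h2
  have hcyc := (hK.prodWeight μ).isCyclic_loopSubgroup ha hk hp hp1 hq hq1
  obtain ⟨x, c, hc, m, hm⟩ := hK.exists_cycle_map μ (hG.tensorProd hH) _ hcyc
  have hc1 : c.length ≠ 1 := fun h => K.irrefl (Walk.adj_of_length_eq_one h)
  obtain ⟨w, hw⟩ := exists_isIncrement hc hc1 m hm
  rcases hw.exists_map_or hc hG hH g₀ h₀ with h | h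
  · exact Or.inl (mapsTo_of_cycle c hc.pos.ne' h)
  · exact Or.inr (mapsTo_of_cycle c hc.pos.ne' h)

end IsSquareFree

end SimpleGraph

/-! ### Reduction to connected factors -/

namespace SimpleGraph

section Multiplicative

variable {X : Type v} {Y : Type w} {V : Type u} {G : SimpleGraph X} {H : SimpleGraph Y}
  {K : SimpleGraph V}

theorem MapsTo.of_connectedComponent (h : ∀ c : G.ConnectedComponent, c.toSimpleGraph.MapsTo K) :
    G.MapsTo K := by
  let F : ∀ c : G.ConnectedComponent, c.toSimpleGraph →g K := fun c => (h c).some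
  let f : X → V := fun x => F (G.connectedComponentMk x) ⟨x, rfl⟩
  have key : ∀ (c : G.ConnectedComponent) (x : X) (hx : x ∈ c), F c ⟨x, hx⟩ = f x := by
    rintro c x rfl
    rfl
  refine ⟨⟨f, fun {x y} hxy => ?_⟩⟩
  have hy : y ∈ G.connectedComponentMk x :=
    (ConnectedComponent.connectedComponentMk_eq_of_adj hxy).symm
  rw [← key _ y hy]
  exact (F (G.connectedComponentMk x)).map_adj hxy

theorem Colorable.mapsTo (hG : G.Colorable 2) {x y : V} (hxy : K.Adj x y) : G.MapsTo K := by
  obtain ⟨c⟩ := hG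
  refine ⟨⟨fun g => if c g = 0 then x else y, fun {g g'} hg => ?_⟩⟩
  have h := c.valid hg
  by_cases h0 : c g = 0 <;> by_cases h1 : c g' = 0
  · exact absurd (h0.trans h1.symm) h
  · simpa [h0, h1] using hxy
  · simpa [h0, h1] using hxy.symm
  · exact absurd (by omega) h

theorem IsSquareFree.mapsTo_or_of_connected [Finite X] [Finite Y] (hK : K.IsSquareFree)
    (μ : G.tensorProd H →g K) (hG : G.Connected) (hH : H.Connected) :
    G.MapsTo K ∨ H.MapsTo K := by
  obtain ⟨g₀⟩ := hG.nonempty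
  obtain ⟨h₀⟩ := hH.nonempty
  by_cases hGe : ∀ g g', ¬ G.Adj g g'
  · exact Or.inl ⟨⟨fun _ => μ (g₀, h₀), fun hg => absurd hg (hGe _ _)⟩⟩
  by_cases hHe : ∀ h h', ¬ H.Adj h h'
  · exact Or.inr ⟨⟨fun _ => μ (g₀, h₀), fun hh => absurd hh (hHe _ _)⟩⟩
  push Not at hGe hHe
  obtain ⟨g, g', hg⟩ := hGe
  obtain ⟨h, h', hh⟩ := hHe
  have hadj : K.Adj (μ (g, h)) (μ (g', h')) := μ.map_adj ⟨hg, hh⟩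
  by_cases hG2 : G.Colorable 2
  · exact Or.inl (hG2.mapsTo hadj)
  by_cases hH2 : H.Colorable 2
  · exact Or.inr (hH2.mapsTo hadj)
  exact hK.mapsTo_or_of_isOddConnected μ (hG.isOddConnected hG2) (hH.isOddConnected hH2) g₀ h₀

theorem IsSquareFree.isMultiplicative {V : Type u} {K : SimpleGraph V} (hK : K.IsSquareFree) :
    IsMultiplicative.{u, v, w} K := by
  intro X Y _ _ G H ⟨μ⟩
  by_contra! hcon
  obtain ⟨c, hc⟩ : ∃ c : G.ConnectedComponent, ¬ c.toSimpleGraph.MapsTo K := by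
    by_contra! h
    exact hcon.1 (.of_connectedComponent h)
  obtain ⟨d, hd⟩ : ∃ d : H.ConnectedComponent, ¬ d.toSimpleGraph.MapsTo K := by
    by_contra! h
    exact hcon.2 (.of_connectedComponent h)
  let μ' : c.toSimpleGraph.tensorProd d.toSimpleGraph →g K :=
    ⟨fun p => μ (p.1.1, p.2.1), fun h => μ.map_adj ⟨h.1, h.2⟩⟩
  exact (hK.mapsTo_or_of_connected μ' c.connected_toSimpleGraph d.connected_toSimpleGraph).elim
    hc hd

end Multiplicative

/-! ### Square-free graphs of large chromatic number -/

/-- Descartes' construction: attach, for every injection of the vertices of `K` into `S`, a copy of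
`K` matched with the image of the injection. -/
def descartes {V : Type*} (K : SimpleGraph V) (S : Type*) : SimpleGraph (S ⊕ (V ↪ S) × V) where
  Adj
    | .inl _, .inl _ => False
    | .inl s, .inr p => s = p.1 p.2
    | .inr p, .inl s => s = p.1 p.2
    | .inr p, .inr q => p.1 = q.1 ∧ K.Adj p.2 q.2
  symm := ⟨by
    rintro (s | p) (t | q) h
    · exact h
    · exact h
    · exact h
    · exact ⟨h.1.symm, h.2.symm⟩⟩
  loopless := ⟨by
    rintro (s | p) h
    · exact h
    · exact K.irrefl h.2⟩

/-- A vertex of `S` has at most one neighbour in each copy, and a vertex of a copy only one in `S`;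
so a four-cycle meeting `S` degenerates, and any other lies in one copy of `K`. -/
theorem IsSquareFree.descartes {V : Type*} {K : SimpleGraph V} (hK : K.IsSquareFree) (S : Type*) :
    (K.descartes S).IsSquareFree := by
  have key : ∀ (s : S) (a b : (V ↪ S) × V) (z : S ⊕ (V ↪ S) × V), s = a.1 a.2 → s = b.1 b.2 →
      (K.descartes S).Adj (.inr a) z → (K.descartes S).Adj z (.inr b) → .inl s = z ∨ a = b := by
    rintro s ⟨f, i⟩ ⟨f', j⟩ (t | ⟨f'', k⟩) ha hb h1 h2
    · have h1 : t = f i := h1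
      exact Or.inl (congrArg _ (ha.trans h1.symm))
    · right
      obtain rfl : f = f'' := h1.1
      obtain rfl : f = f' := h2.1
      have hij : i = j := f.injective (ha.symm.trans hb)
      rw [hij]
  rintro (s | a) (t | b) (u | c) (x | d) h1 h2 h3 h4
  any_goals exact absurd h1 id
  any_goals exact absurd h2 id
  any_goals exact absurd h3 id
  any_goals exact absurd h4 id
  · exact (key s b d _ h1 h4 h2 h3).imp id (congrArg _)
  · exact (key s b d _ h1 h4 h2 h3).imp id (congrArg _)
  · exact ((key t c a _ h2 h1 h3 h4).imp id (congrArg _)).symm.imp Eq.symm id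
  · exact ((key t c a _ h2 h1 h3 h4).imp id (congrArg _)).symm.imp Eq.symm id
  · exact ((key u d b _ h3 h2 h4 h1).imp id (congrArg _)).imp Eq.symm Eq.symm
  · exact ((key x a c _ h4 h3 h1 h2).imp id (congrArg _)).symm.imp id Eq.symm
  · obtain ⟨f, i⟩ := a
    obtain ⟨f₁, j⟩ := b
    obtain ⟨f₂, k⟩ := c
    obtain ⟨f₃, l⟩ := d
    obtain rfl : f = f₁ := h1.1
    obtain rfl : f = f₂ := h2.1
    obtain rfl : f = f₃ := h3.1
    exact (hK i j k l h1.2 h2.2 h3.2 h4.2).imp (fun e => by rw [e]) fun e => by rw [e]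

/-- By pigeonhole some injection has an image of a single colour; the copy attached to it avoids
that colour, which would colour `K` with `n` colours. -/
theorem not_colorable_descartes {V S : Type*} [Fintype V] [Fintype S] {K : SimpleGraph V} {n : ℕ}
    (hK : ¬ K.Colorable n) (hS : (n + 1) * Fintype.card V ≤ Fintype.card S) :
    ¬ (K.descartes S).Colorable (n + 1) := by
  classical
  rintro ⟨c⟩
  obtain ⟨a, ha⟩ := Fintype.exists_le_card_fiber_of_mul_le_card (fun s : S => c (.inl s))
    (n := Fintype.card V) (by simpa using hS)
  rw [← Fintype.card_subtype] at ha
  obtain ⟨f⟩ := Function.Embedding.nonempty_of_card_le ha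
  let f' : V ↪ S := f.trans (Function.Embedding.subtype _)
  have hf' : ∀ i, c (.inl (f' i)) = a := fun i => (f i).2
  have hne : ∀ i, c (.inr (f', i)) ≠ a := fun i => by
    rw [← hf' i]
    exact (c.valid (show (K.descartes S).Adj (.inl (f' i)) (.inr (f', i)) from rfl)).symm
  let c' : K.Coloring {x : Fin (n + 1) // x ≠ a} :=
    Coloring.mk (fun i => ⟨c (.inr (f', i)), hne i⟩) fun {i j} hij e =>
      c.valid (show (K.descartes S).Adj (.inr (f', i)) (.inr (f', j)) from ⟨rfl, hij⟩)
        (congrArg Subtype.val e)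
  have := c'.colorable
  rw [Fintype.card_subtype_compl, Fintype.card_fin, Fintype.card_subtype_eq,
    Nat.add_sub_cancel] at this
  exact hK this

theorem exists_isSquareFree_not_colorable (n : ℕ) :
    ∃ (V : Type) (_ : Fintype V) (K : SimpleGraph V), K.IsSquareFree ∧ ¬ K.Colorable n := by
  classical
  induction n with
  | zero =>
    refine ⟨Unit, inferInstance, ⊥, fun _ _ _ _ h => absurd h id, ?_⟩
    rintro ⟨c⟩
    exact (c ()).elim0
  | succ n ih =>
    obtain ⟨V, _, K, hK, hn⟩ := ih
    exact ⟨_, inferInstance, K.descartes (Fin ((n + 1) * Fintype.card V)), hK.descartes _,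
      not_colorable_descartes hn (by simp)⟩

theorem IsSquareFree.of_iso {V W : Type*} {K : SimpleGraph V} {K' : SimpleGraph W}
    (hK : K.IsSquareFree) (φ : K' ≃g K) : K'.IsSquareFree := fun _ _ _ _ h1 h2 h3 h4 =>
  (hK _ _ _ _ (φ.map_adj_iff.2 h1) (φ.map_adj_iff.2 h2) (φ.map_adj_iff.2 h3)
    (φ.map_adj_iff.2 h4)).imp (fun e => φ.injective e) fun e => φ.injective e

end SimpleGraph

theorem mainTheorem1 :
    (∀ (V : Type u) [Finite V] (K : SimpleGraph V),
      K.IsSquareFree → SimpleGraph.IsMultiplicative.{u, v, w} K) ∧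
    (∀ n : ℕ, ∃ (m : ℕ) (K : SimpleGraph (Fin m)),
      K.IsSquareFree ∧ SimpleGraph.IsMultiplicative.{0, v, w} K ∧
        (n : ℕ∞) ≤ K.chromaticNumber) := by
  refine ⟨fun V _ K hK => hK.isMultiplicative, fun n => ?_⟩
  obtain ⟨V, _, K, hK, hn⟩ := SimpleGraph.exists_isSquareFree_not_colorable n
  have hK' := hK.of_iso (K.overFinIso rfl).symm
  refine ⟨Fintype.card V, K.overFin rfl, hK', hK'.isMultiplicative, ?_⟩
  refine (not_le.1 fun h => hn ?_).le
  exact (SimpleGraph.chromaticNumber_le_iff_colorable.1 h).of_hom (K.overFinIso rfl).toHom
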